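/- Let $K$ be a knot in $S^3$ that has a planar diagram with $c+2$ crossings, where $c\ge 0$ is an integer. For $n\ge 1$ let $J_K(n)\in\mathbb Z[q^{\pm1}]$ be the Jones polynomial of $K$ (with framing zero) colored by the $n$-dimensional irreducible representation of $\mathfrak{sl}_2$, normalized to be $1$ for the unknot; it is computed from a long knot diagram whose closure is the given diagram of $K$, by the $R$-matrix state sum in which the two broken ends have color $0$, corrected by the writhe. For a real number $\alpha$ let $\mathrm{ev}_{\alpha,n}(f)$ denote the value of $f$ at $q=e^{2\pi i\alpha/n}$. Then for every real $\alpha>0$ $$\limsup_{n\to\infty}\frac{\log\bigl|\mathrm{ev}_{\alpha,n}(J_K(n))\bigr|}{n}\;\le\; c\log 4,$$ where $\log 0=-\infty$, and the limsup is taken in $[-\infty,+\infty]$. -/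

import Mathlib

open scoped LaurentPolynomial

noncomputable section

namespace ColoredJones

/-! ### Oriented long knot diagrams

A diagram in general position with respect to the height function is read from bottom to top as a
word in elementary slices. Each slice consists of vertical strands and of one elementary piece: a
crossing of two strands that both go up, or a local minimum (cup) or local maximum (cap) with one
of its two orientations. Every oriented planar diagram is brought into this form by an isotopy of
the plane that rotates its crossings into upright position, without changing the crossings. -/

/-- The direction in which an oriented strand passes through a horizontal level. -/
inductive Strand
  | up
  | down

/-- The elementary pieces. In `posCrossing` the strand from bottom left to top right passes over
the other one, in `negCrossing` it passes under it. The letters in the names of the cups and caps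
are the directions of their two ends, from left to right. -/
inductive Piece
  | posCrossing
  | negCrossing
  | cupUD
  | cupDU
  | capUD
  | capDU

open Strand

/-- The strands that enter a piece at its bottom, from left to right. -/
def Piece.bot : Piece → List Strand
  | posCrossing => [up, up]
  | negCrossing => [up, up]
  | cupUD => []
  | cupDU => []
  | capUD => [up, down]
  | capDU => [down, up]

/-- The strands that leave a piece at its top, from left to right. -/
def Piece.top : Piece → List Strand
  | posCrossing => [up, up]
  | negCrossing => [up, up]
  | cupUD => [up, down]
  | cupDU => [down, up]
  | capUD => []
  | capDU => []

/-- The sign of a crossing, and `0` for cups and caps. -/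
def Piece.sign : Piece → ℤ
  | posCrossing => 1
  | negCrossing => -1
  | _ => 0

/-- A slice: an elementary piece with `left` vertical strands to the left of it, and with as many
vertical strands to the right of it as the slice below leaves. -/
structure Slice where
  left : ℕ
  piece : Piece

/-- `IsTangle w s t`: the word `w`, read from bottom to top, is an oriented tangle diagram with
the sequence of strands `s` at its bottom and the sequence of strands `t` at its top. -/
inductive IsTangle : List Slice → List Strand → List Strand → Prop
  | nil (s : List Strand) : IsTangle [] s s
  | cons (L R t : List Strand) (p : Piece) (w : List Slice)
      (h : IsTangle w (L ++ p.top ++ R) t) :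
      IsTangle (⟨L.length, p⟩ :: w) (L ++ p.bot ++ R) t

/-- The number of strands at the top of the word `w` if there are `m` strands at its bottom. -/
def width (m : ℕ) (w : List Slice) : ℕ :=
  w.foldl (fun k s => k - s.piece.bot.length + s.piece.top.length) m

/-- The points in which a word with one strand at its bottom meets the horizontal levels between
its slices: `(h, i)` is the `i`-th point, counted from the left and from `0`, of the level above
the first `h` slices. -/
def IsPoint (w : List Slice) (p : ℕ × ℕ) : Prop :=
  p.1 ≤ w.length ∧ p.2 < width 1 (w.take p.1)

/-- Two points are the ends of one of the pieces of curve of which a slice consists. -/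
inductive Joined (w : List Slice) : ℕ × ℕ → ℕ × ℕ → Prop
  | left (h i : ℕ) (s : Slice) (hs : w[h]? = some s) (hi : i < s.left) :
      Joined w (h, i) (h + 1, i)
  | right (h i : ℕ) (s : Slice) (hs : w[h]? = some s)
      (hi : s.left + s.piece.bot.length + i < width 1 (w.take h)) :
      Joined w (h, s.left + s.piece.bot.length + i) (h + 1, s.left + s.piece.top.length + i)
  | rising (h : ℕ) (s : Slice) (hs : w[h]? = some s) (hp : s.piece.sign ≠ 0) :
      Joined w (h, s.left) (h + 1, s.left + 1)
  | falling (h : ℕ) (s : Slice) (hs : w[h]? = some s) (hp : s.piece.sign ≠ 0) :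
      Joined w (h, s.left + 1) (h + 1, s.left)
  | cup (h : ℕ) (s : Slice) (hs : w[h]? = some s) (hp : s.piece.bot = []) :
      Joined w (h + 1, s.left) (h + 1, s.left + 1)
  | cap (h : ℕ) (s : Slice) (hs : w[h]? = some s) (hp : s.piece.top = []) :
      Joined w (h, s.left) (h, s.left + 1)

/-- An oriented long knot diagram: a tangle diagram with one upward strand at the bottom and one
at the top, which has a single component. Joining its two ends by an arc without crossings gives a
diagram of a knot with the same crossings, and every diagram of a knot, cut open at any edge of
its outer region, is obtained in this way. -/
structure LongKnotDiagram where
  word : List Slice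
  isTangle : IsTangle word [up] [up]
  connected : ∀ p q : ℕ × ℕ, IsPoint word p → IsPoint word q → Relation.EqvGen (Joined word) p q

/-- The number of crossings. -/
def LongKnotDiagram.crossings (D : LongKnotDiagram) : ℕ :=
  (D.word.filter (fun s => s.piece.sign ≠ 0)).length

/-- The writhe, that is the number of positive minus the number of negative crossings. -/
def LongKnotDiagram.writhe (D : LongKnotDiagram) : ℤ :=
  (D.word.map (fun s => s.piece.sign)).sum

/-! ### The colored Jones polynomial

The ring is `ℤ[x, x⁻¹]`, whose variable `x = T 1` stands for `q ^ (1/4)`; so `v = q ^ (1/2)` is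
`T 2`, and `q` is `T 4`. -/

open LaurentPolynomial

/-- The `q`-integer `{a} = v ^ a - v ^ (-a)`. -/
def qint (a : ℤ) : ℤ[T;T⁻¹] := T (2 * a) - T (-(2 * a))

/-- The falling product `{a}_b = {a} {a - 1} ⋯ {a - b + 1}`. -/
def qfalling (a : ℤ) (b : ℕ) : ℤ[T;T⁻¹] := ∏ i ∈ Finset.range b, qint (a - i)

/-- The balanced `q`-binomial coefficient, through its Pascal recursion. -/
def qbinom : ℕ → ℕ → ℤ[T;T⁻¹]
  | _, 0 => 1
  | 0, _ + 1 => 0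
  | a + 1, b + 1 => T (2 * (b + 1)) * qbinom a (b + 1) + T (2 * (b - a)) * qbinom a b

/-- The weight `R₊(n; a, b, k)` of a positive crossing. -/
def Rpos (n a b k : ℕ) : ℤ[T;T⁻¹] :=
  (-1) ^ k * T (-(((n : ℤ) - 1 - 2 * a) * (n - 1 - 2 * b) + k * (k - 1))) *
    qbinom (b + k) k * qfalling (n - 1 + k - a) k

/-- The weight `R₋(n; a, b, k)` of a negative crossing. -/
def Rneg (n a b k : ℕ) : ℤ[T;T⁻¹] :=
  T (((n : ℤ) - 1 - 2 * a - 2 * k) * (n - 1 - 2 * b + 2 * k) + k * (k - 1)) *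
    qbinom (a + k) k * qfalling (n - 1 + k - b) k

/-- The state sum. Part-arcs are colored by the elements of `{0, …, n - 1}`, which index a basis
of the `n`-dimensional irreducible representation. `stateSum n w i j` is the sum of the products
of the local weights over all colorings of the word `w` that restrict to `i` at its bottom and to
`j` at its top; it is the matrix entry of the operator invariant of the tangle. At a crossing with
angle variable `k`, the color decreases by `k` along the overpass and increases by `k` along the
underpass. -/
def stateSum (n : ℕ) : List Slice → List ℕ → List ℕ → ℤ[T;T⁻¹]
  | [], i, j => if i = j then 1 else 0
  | ⟨l, .posCrossing⟩ :: w, i, j =>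
    match i.drop l with
    | a :: b :: r =>
      ∑ k ∈ Finset.range n with k ≤ a ∧ b + k < n,
        Rpos n a b k * stateSum n w (i.take l ++ (b + k) :: (a - k) :: r) j
    | _ => 0
  | ⟨l, .negCrossing⟩ :: w, i, j =>
    match i.drop l with
    | a :: b :: r =>
      ∑ k ∈ Finset.range n with k ≤ b ∧ a + k < n,
        Rneg n a b k * stateSum n w (i.take l ++ (b - k) :: (a + k) :: r) j
    | _ => 0
  | ⟨l, .cupUD⟩ :: w, i, j =>
    ∑ a ∈ Finset.range n, stateSum n w (i.take l ++ a :: a :: i.drop l) j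
  | ⟨l, .cupDU⟩ :: w, i, j =>
    ∑ a ∈ Finset.range n,
      T (2 * ((n : ℤ) - 1 - 2 * a)) * stateSum n w (i.take l ++ a :: a :: i.drop l) j
  | ⟨l, .capUD⟩ :: w, i, j =>
    match i.drop l with
    | a :: b :: r =>
      if a = b then T (-(2 * ((n : ℤ) - 1 - 2 * a))) * stateSum n w (i.take l ++ r) j else 0
    | _ => 0
  | ⟨l, .capDU⟩ :: w, i, j =>
    match i.drop l with
    | a :: b :: r => if a = b then stateSum n w (i.take l ++ r) j else 0
    | _ => 0

/-- The `n`-th colored Jones polynomial (`1 ≤ n`) of the knot presented by a diagram: color the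
knot by the `n`-dimensional irreducible representation, give the two broken ends the color `0`,
and correct the framing by the writhe. The unknot has the value `1`. -/
def coloredJones (D : LongKnotDiagram) (n : ℕ) : ℤ[T;T⁻¹] :=
  T (((n : ℤ) ^ 2 - 1) * D.writhe) * stateSum n D.word [0] [0]

/-- Evaluation at `q = exp (2 π i α / n)`, that is at `q ^ (1/4) = exp (2 π i α / (4 n))`. -/
def ev (α : ℝ) (n : ℕ) (f : ℤ[T;T⁻¹]) : ℂ :=
  LaurentPolynomial.eval₂ (Int.castRingHom ℂ)
    (Units.mk0 (Complex.exp (2 * Real.pi * Complex.I * α / (4 * n))) (Complex.exp_ne_zero _)) f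

/-! ### The `q`-binomial coefficient as a quotient of `q`-factorials -/

theorem qfalling_succ (a : ℤ) (b : ℕ) :
    qfalling a (b + 1) = qint a * qfalling (a - 1) b := by
  unfold qfalling
  rw [Finset.prod_range_succ']
  simp only [Nat.cast_zero, sub_zero, Nat.cast_add, Nat.cast_one]
  rw [mul_comm]
  congr 1
  refine Finset.prod_congr rfl fun i _ => ?_
  congr 1
  ring

theorem qfalling_succ' (a : ℤ) (b : ℕ) :
    qfalling a (b + 1) = qfalling a b * qint (a - b) := by
  unfold qfalling
  rw [Finset.prod_range_succ]

theorem qint_split (a b : ℤ) :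
    T (2 * (b + 1)) * qint (a - b) + T (2 * (b - a)) * qint (b + 1) = qint (a + 1) := by
  simp only [qint, mul_sub, ← T_add]
  ring_nf

/-- `qbinom a b` is the quotient of `{a}! / {a - b}! = {a}_b` by `{b}! = {b}_b`. -/
theorem qbinom_mul_qfalling (a b : ℕ) : qbinom a b * qfalling b b = qfalling a b := by
  induction a generalizing b with
  | zero => cases b with
    | zero => simp [qbinom, qfalling]
    | succ b => simp [qbinom, qfalling_succ, qint]
  | succ a ih => cases b with
    | zero => simp [qbinom, qfalling]
    | succ b =>
      have h2 := ih b
      have h3 : qfalling ((b + 1 : ℕ) : ℤ) (b + 1) = qint (b + 1) * qfalling b b := by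
        rw [qfalling_succ]; simp
      have h4 : qfalling ((a + 1 : ℕ) : ℤ) (b + 1) = qint (a + 1) * qfalling a b := by
        rw [qfalling_succ]; simp
      rw [h4, ← qint_split a b, qbinom]
      calc _ = T (2 * ((b : ℤ) + 1)) * (qbinom a (b + 1) * qfalling ((b + 1 : ℕ) : ℤ) (b + 1))
            + T (2 * ((b : ℤ) - a)) * qbinom a b * qfalling ((b + 1 : ℕ) : ℤ) (b + 1) := by ring
        _ = _ := by
          rw [ih (b + 1), qfalling_succ' (a : ℤ) b, h3, ← h2]; ring

end ColoredJones

end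

noncomputable section

namespace ColoredJones

open LaurentPolynomial Strand

/-! ### Local weights -/

/-! Evaluation takes every power of `T` to a number of modulus one. The weight of a crossing with
angle `k` is therefore at most a binomial coefficient times `2 ^ k`, hence at most `4 ^ n`, and it
has modulus at most one if `k = 0` (`norm_evHom_pieceWt_le`). A state is determined by its initial
color and the variables of its slices, so the number of states is polynomial in `n`. This alone
bounds the growth rate by `(c + 2) log 4`; what remains is to make two crossings cost nothing.

By connectedness some edge runs from one crossing to a different one (`exists_edge`). Colors
decrease by the angle along an overpass, increase by it along an underpass, and stay in `{0, …, n -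
1}`. Hence an extreme color, `0` or `n - 1`, given to this edge or to the edge that precedes it on
the same strand, forces the angles of both crossings to vanish (`exists_point_color`).

Such a color may be prescribed because the state sum can be cut open at any edge and with any color
(`cutSum_eq_stateSum`). The reason is quantum group symmetry: the operator of a tangle commutes with
the raising operator `E` (`act_eAct`), which is checked piece by piece, and it preserves the weight
(`act_weight`). The trace over the broken strand kills commutators with `E` (`cutTrace_eAct_comm`),
and the commutator of `E` with a suitably twisted off-diagonal matrix unit is a multiple of the
difference of two neighboring diagonal ones (`eAct_insertUnit`); so the cut sum does not depend on
the color.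

To change the edge, weight the colors of the cut strand by `K` or by its inverse and sum. The result
is the cut sum times the quantum dimension, and it is also the trace twisted at the gap to the right
or to the left of the strand. So all gaps of a level give the same trace. At the outermost gap the
twist is the total weight, which does not change with the level. The quantum dimension is cancelled
in the Laurent polynomial ring, before evaluation, where it may become zero. -/

/-- The weight of the basis vector with color `a`. -/
def wexp (n : ℕ) : Strand → ℕ → ℤ
  | up, a => (n : ℤ) - 1 - 2 * a
  | down, a => -((n : ℤ) - 1 - 2 * a)

/-- The weight of a positive crossing, for all angle variables. -/
def posWt (n a b k : ℕ) : ℤ[T;T⁻¹] := if k ≤ a ∧ b + k < n then Rpos n a b k else 0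

/-- The weight of a negative crossing, for all angle variables. -/
def negWt (n a b k : ℕ) : ℤ[T;T⁻¹] := if k ≤ b ∧ a + k < n then Rneg n a b k else 0

theorem posWt_pos {n a b k : ℕ} (h : k ≤ a ∧ b + k < n) : posWt n a b k = Rpos n a b k := if_pos h

theorem posWt_neg {n a b k : ℕ} (h : ¬(k ≤ a ∧ b + k < n)) : posWt n a b k = 0 := if_neg h

theorem negWt_pos {n a b k : ℕ} (h : k ≤ b ∧ a + k < n) : negWt n a b k = Rneg n a b k := if_pos h

theorem negWt_neg {n a b k : ℕ} (h : ¬(k ≤ b ∧ a + k < n)) : negWt n a b k = 0 := if_neg h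

/-- The weight of a piece in the state in which its variable is `k`, with colors `m` at its bottom.
The variable is the angle of a crossing, the color of a cup, and is `0` at a cap. -/
def pieceWt (n : ℕ) : Piece → ℕ → List ℕ → ℤ[T;T⁻¹]
  | .posCrossing, k, [a, b] => posWt n a b k
  | .negCrossing, k, [a, b] => negWt n a b k
  | .cupUD, _, [] => 1
  | .cupDU, k, [] => T (2 * ((n : ℤ) - 1 - 2 * k))
  | .capUD, k, [a, b] => if k = 0 ∧ a = b then T (-(2 * ((n : ℤ) - 1 - 2 * a))) else 0
  | .capDU, k, [a, b] => if k = 0 ∧ a = b then 1 else 0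
  | _, _, _ => 0

/-- The colors at the top of a piece with variable `k` and with colors `m` at its bottom. -/
def pieceOut : Piece → ℕ → List ℕ → List ℕ
  | .posCrossing, k, [a, b] => [b + k, a - k]
  | .negCrossing, k, [a, b] => [b - k, a + k]
  | .cupUD, k, [] => [k, k]
  | .cupDU, k, [] => [k, k]
  | _, _, _ => []

/-- The operator of a piece, on functions of the colors at its top. -/
def pieceAct (n : ℕ) (p : Piece) (v : List ℕ → ℤ[T;T⁻¹]) (m : List ℕ) : ℤ[T;T⁻¹] :=
  ∑ k ∈ Finset.range n, pieceWt n p k m * v (pieceOut p k m)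

/-- The color of the image of a basis vector under the raising operator `E`. -/
def shift : Strand → ℕ → ℕ
  | up, a => a - 1
  | down, a => a + 1

/-- The coefficients of the raising operator `E`. -/
def eCoef (n : ℕ) : Strand → ℕ → ℤ[T;T⁻¹]
  | up, a => if a = 0 then 0 else qint ((n : ℤ) - a)
  | down, a => -(T (-(2 * ((n : ℤ) - 1 - 2 * a))) * qint ((n : ℤ) - 1 - a))

/-- The total weight of a sequence of colors. -/
def wexps (n : ℕ) : List Strand → List ℕ → ℤ
  | st :: s, a :: i => wexp n st a + wexps n s i
  | _, _ => 0

/-- The action of `E`, with the coproduct `E ⊗ 1 + K ⊗ E`, on functions of the colors. -/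
def eAct (n : ℕ) : List Strand → (List ℕ → ℤ[T;T⁻¹]) → List ℕ → ℤ[T;T⁻¹]
  | st :: s, v, a :: i =>
    eCoef n st a * v (shift st a :: i) + T (2 * wexp n st a) * eAct n s (fun i' => v (a :: i')) i
  | _, _, _ => 0

/-! ### Identities for `q`-integers and `q`-binomials -/

theorem qint_zero : qint 0 = 0 := by simp [qint]

theorem qint_ne_zero {a : ℤ} (ha : a ≠ 0) : qint a ≠ 0 := by
  intro h
  have h1 := congrArg (fun f : ℤ[T;T⁻¹] => f.coeff (2 * a)) (sub_eq_zero.mp h)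
  simp only [T_apply, if_true] at h1
  rw [if_neg (by omega)] at h1
  exact one_ne_zero h1

theorem qfalling_self_ne_zero (b : ℕ) : qfalling b b ≠ 0 := by
  refine Finset.prod_ne_zero_iff.mpr fun i hi => qint_ne_zero ?_
  have := Finset.mem_range.mp hi
  omega

/-- The only relation between `q`-integers that the commutation of the crossings with `E` needs
beyond the recursions of binomials and falling products. -/
theorem qint_exchange (u b k : ℤ) :
    qint (u - k) * qint (k + 1) =
      qint (b + k + 1) * qint (u + b - k) - qint (u + b + 1) * qint b := by
  simp only [qint, mul_sub, sub_mul, ← T_add]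
  ring_nf

theorem qfalling_succ_self (k : ℕ) :
    qfalling ((k + 1 : ℕ) : ℤ) (k + 1) = qint (k + 1) * qfalling k k := by
  rw [qfalling_succ]; simp

/-- This and the next identity follow from the quotient formula `qbinom_mul_qfalling` by cancelling
`{k}!`, which is nonzero in a domain. -/
theorem qbinom_succ_mul (a k : ℕ) :
    qbinom (a + 1) (k + 1) * qint (k + 1) = qbinom a k * qint (a + 1) := by
  refine mul_right_cancel₀ (qfalling_self_ne_zero k) ?_
  have h1 := qbinom_mul_qfalling (a + 1) (k + 1)
  rw [qfalling_succ_self, qfalling_succ] at h1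
  rw [mul_assoc, h1, mul_right_comm, qbinom_mul_qfalling]
  simp [mul_comm]

theorem qbinom_mul_succ (b k : ℕ) :
    qbinom (b + k) (k + 1) * qint (k + 1) = qbinom (b + k) k * qint b := by
  refine mul_right_cancel₀ (qfalling_self_ne_zero k) ?_
  have h1 := qbinom_mul_qfalling (b + k) (k + 1)
  rw [qfalling_succ_self, qfalling_succ'] at h1
  rw [mul_assoc, h1, mul_right_comm, qbinom_mul_qfalling]
  simp

theorem qfalling_shift (m : ℤ) (k : ℕ) :
    qfalling (m + k) k * qint m = qfalling (m - 1 + k) k * qint (m + k) := by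
  have h1 := qfalling_succ (m + k) k
  have h2 := qfalling_succ' (m + k) k
  rw [h2] at h1
  rw [show m + (k : ℤ) - k = m by ring, show m + (k : ℤ) - 1 = m - 1 + k by ring] at h1
  rw [h1]; ring

/-- The factor `{k + 1}` clears the denominator by which the binomials of angles `k` and `k + 1`
differ, so that both are expressed through `qbinom (b + k) k`. -/
theorem Rpos_succ_mul (n a b k : ℕ) (hb : 0 < b) :
    Rpos n a (b - 1) (k + 1) * qint (k + 1) =
      (-1) ^ (k + 1) * T (-(((n : ℤ) - 1 - 2 * a) * (n - 1 - 2 * b + 2) + (k + 1) * k)) *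
        qbinom (b + k) k * qint b * qfalling (n + k - a) (k + 1) := by
  obtain ⟨b, rfl⟩ : ∃ c, b = c + 1 := ⟨b - 1, by omega⟩
  have h := qbinom_mul_succ (b + 1) k
  rw [Rpos, Nat.add_sub_cancel, show b + (k + 1) = b + 1 + k by ring]
  rw [show (n : ℤ) - 1 + ((k + 1 : ℕ) : ℤ) - a = n + k - a by push_cast; ring,
    show -(((n : ℤ) - 1 - 2 * a) * (n - 1 - 2 * b) + ((k + 1 : ℕ) : ℤ) * (((k + 1 : ℕ) : ℤ) - 1))
      = -(((n : ℤ) - 1 - 2 * a) * (n - 1 - 2 * (b + 1 : ℕ) + 2) + (k + 1) * k) by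
      push_cast; ring]
  linear_combination (-1) ^ (k + 1) *
    T (-(((n : ℤ) - 1 - 2 * a) * (n - 1 - 2 * (b + 1 : ℕ) + 2) + (k + 1) * k)) *
      qfalling (n + k - a) (k + 1) * h

theorem Rneg_succ_mul (n a b k : ℕ) (ha : 0 < a) :
    Rneg n (a - 1) b (k + 1) * qint (k + 1) =
      T (((n : ℤ) - 1 - 2 * a - 2 * k) * (n - 1 - 2 * b + 2 * k + 2) + (k + 1) * k) *
        qbinom (a + k) k * qint a * qfalling (n + k - b) (k + 1) := by
  obtain ⟨a, rfl⟩ : ∃ c, a = c + 1 := ⟨a - 1, by omega⟩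
  have h := qbinom_mul_succ (a + 1) k
  rw [Rneg, Nat.add_sub_cancel, show a + (k + 1) = a + 1 + k by ring]
  rw [show (n : ℤ) - 1 + ((k + 1 : ℕ) : ℤ) - b = n + k - b by push_cast; ring,
    show ((n : ℤ) - 1 - 2 * a - 2 * (k + 1 : ℕ)) * (n - 1 - 2 * b + 2 * (k + 1 : ℕ))
        + ((k + 1 : ℕ) : ℤ) * (((k + 1 : ℕ) : ℤ) - 1)
      = ((n : ℤ) - 1 - 2 * (a + 1 : ℕ) - 2 * k) * (n - 1 - 2 * b + 2 * k + 2) + (k + 1) * k by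
      push_cast; ring]
  linear_combination
    T (((n : ℤ) - 1 - 2 * (a + 1 : ℕ) - 2 * k) * (n - 1 - 2 * b + 2 * k + 2) + (k + 1) * k) *
      qfalling (n + k - b) (k + 1) * h

theorem eCoef_up_zero (n : ℕ) : eCoef n up 0 = 0 := by simp [eCoef]

theorem eCoef_up_of_pos {n a : ℕ} (ha : 0 < a) : eCoef n up a = qint ((n : ℤ) - a) := by
  rw [eCoef, if_neg (by omega)]

/-- The factor `{b}` on the right vanishes at `b = 0`, as `eCoef n up 0` does, so the truncated `b -
1` needs no separate treatment afterwards. -/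
theorem eCoef_mul_Rpos (n a b k : ℕ) :
    eCoef n up b * Rpos n a (b - 1) (k + 1) * qint (k + 1) =
      (-1) ^ (k + 1) * T (-(((n : ℤ) - 1 - 2 * a) * (n - 1 - 2 * b + 2) + (k + 1) * k)) *
        qbinom (b + k) k * (qint ((n : ℤ) - b) * qint b) * qfalling (n + k - a) (k + 1) := by
  rcases Nat.eq_zero_or_pos b with rfl | h
  · simp [qint_zero, eCoef]
  · rw [mul_assoc, Rpos_succ_mul n a b k h, eCoef_up_of_pos h]; ring

theorem eCoef_mul_Rneg (n a b k : ℕ) :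
    eCoef n up a * Rneg n (a - 1) b (k + 1) * qint (k + 1) =
      T (((n : ℤ) - 1 - 2 * a - 2 * k) * (n - 1 - 2 * b + 2 * k + 2) + (k + 1) * k) *
        qbinom (a + k) k * (qint ((n : ℤ) - a) * qint a) * qfalling (n + k - b) (k + 1) := by
  rcases Nat.eq_zero_or_pos a with rfl | h
  · simp [qint_zero, eCoef]
  · rw [mul_assoc, Rneg_succ_mul n a b k h, eCoef_up_of_pos h]; ring

theorem qint_exchange_T (e u b k : ℤ) :
    (T (e + (2 * u - 2 * k)) - T (e - (2 * u - 2 * k))) * qint (k + 1) =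
      T e * (qint (b + k + 1) * qint (u + b - k) - qint (u + b + 1) * qint b) := by
  have h : qint (u - k) = T (2 * u - 2 * k) - T (-(2 * u - 2 * k)) := by rw [qint, mul_sub]
  rw [← qint_exchange, sub_eq_add_neg e, T_add, T_add, h]
  ring

/-! ### Commutation of the crossings with `E` -/

theorem Rpos_exchange (n a b k : ℕ) :
    Rpos n (a + 1) b (k + 1) * qint ((n : ℤ) - b - k - 1)
      + Rpos n (a + 1) b k *
        (T (2 * ((n : ℤ) - 1 - 2 * (b + k))) * qint ((n : ℤ) - (a + 1) + k))
    = qint ((n : ℤ) - (a + 1)) * Rpos n a b k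
      + T (2 * ((n : ℤ) - 1 - 2 * (a + 1))) *
        (eCoef n up b * Rpos n (a + 1) (b - 1) (k + 1)) := by
  -- After multiplication by `{k + 1}` all four terms share `qbinom (b + k) k`, and the identity
  -- becomes `qint_exchange` times common factors.
  refine mul_right_cancel₀ (qint_ne_zero (by omega : (k : ℤ) + 1 ≠ 0)) ?_
  rw [add_mul, add_mul, mul_assoc (T _) _ (qint (k + 1)), eCoef_mul_Rpos]
  have h1 := qbinom_succ_mul (b + k) k
  have h2 := qfalling_shift ((n : ℤ) - (a + 1)) k
  have h3 := qfalling_succ ((n : ℤ) + k - (a + 1)) k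
  have h4 := qint_exchange_T (-(((n : ℤ) - 1 - 2 * (a + 1)) * (n - 1 - 2 * b) + (k + 1) * k))
    ((n : ℤ) - 1 - 2 * b) b k
  simp only [Rpos]
  push_cast
  rw [show b + (k + 1) = b + k + 1 by ring]
  rw [show (n : ℤ) - (a + 1) + k = n + k - (a + 1) by ring] at *
  rw [show (n : ℤ) - (a + 1) - 1 + k = n + k - (a + 1) - 1 by ring] at h2
  rw [show (n : ℤ) - 1 + (k + 1) - (a + 1) = n + k - (a + 1) by ring,
    show (n : ℤ) - 1 + k - (a + 1) = n + k - (a + 1) - 1 by ring,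
    show (n : ℤ) - 1 + k - a = n + k - (a + 1) by ring]
  rw [show (n : ℤ) - 1 - 2 * b + b + 1 = n - b by ring,
    show (n : ℤ) - 1 - 2 * b + b - k = n - b - k - 1 by ring] at h4
  push_cast at h1
  -- All powers of `T` that occur are rewritten relative to this one exponent.
  set e : ℤ := -(((n : ℤ) - 1 - 2 * (a + 1)) * (n - 1 - 2 * b) + (k + 1) * k) with he
  have t1 : (T (-(((n : ℤ) - 1 - 2 * (a + 1)) * (n - 1 - 2 * b) + (k + 1) * (k + 1 - 1))) :
      ℤ[T;T⁻¹]) = T e := by rw [he]; ring_nf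
  have t2 : (T (-(((n : ℤ) - 1 - 2 * (a + 1)) * (n - 1 - 2 * b) + k * (k - 1))) : ℤ[T;T⁻¹]) *
      T (2 * ((n : ℤ) - 1 - 2 * (b + k))) = T (e + (2 * ((n : ℤ) - 1 - 2 * b) - 2 * k)) := by
    rw [he, ← T_add]; ring_nf
  have t3 : (T (-(((n : ℤ) - 1 - 2 * a) * (n - 1 - 2 * b) + k * (k - 1))) : ℤ[T;T⁻¹]) =
      T (e - (2 * ((n : ℤ) - 1 - 2 * b) - 2 * k)) := by
    rw [he]; ring_nf
  have t4 : (T (2 * ((n : ℤ) - 1 - 2 * (a + 1))) : ℤ[T;T⁻¹]) *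
      T (-(((n : ℤ) - 1 - 2 * (a + 1)) * (n - 1 - 2 * b + 2) + (k + 1) * k)) = T e := by
    rw [he, ← T_add]; ring_nf
  rw [t1, t3]
  generalize qfalling ((n : ℤ) + k - (a + 1)) (k + 1) = F at *
  generalize qfalling ((n : ℤ) + k - (a + 1) - 1) k = G at *
  generalize qfalling ((n : ℤ) + k - (a + 1)) k = H at *
  generalize qint ((n : ℤ) + k - (a + 1)) = M at *
  generalize qint ((n : ℤ) - b - k - 1) = N at *
  linear_combination (-(-1) ^ k * T e * F * N) * h1
    + ((-1) ^ k * qbinom (b + k) k * G * M * qint (k + 1)) * t2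
    - ((-1) ^ k * qbinom (b + k) k * qint (k + 1) *
        T (e - (2 * ((n : ℤ) - 1 - 2 * b) - 2 * k))) * h2
    + ((-1) ^ k * qbinom (b + k) k * qint (n - b) * qint b * F) * t4
    + ((-1) ^ k * qbinom (b + k) k * G * M) * h4
    + ((-1) ^ k * T e * qbinom (b + k) k *
        (qint (n - b) * qint b - qint (b + k + 1) * N)) * h3

/-- The mirror image of `Rpos_exchange`: the two strands exchange their roles, and the same identity
for `q`-integers is used with the color `a` in place of `b`. -/
theorem Rneg_exchange (n a b k : ℕ) :
    Rneg n a (b + 1) (k + 1) *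
        (T (2 * ((n : ℤ) - 1 - 2 * (b - k))) * qint ((n : ℤ) - a - k - 1))
      + Rneg n a (b + 1) k * qint ((n : ℤ) - (b + 1) + k)
    = eCoef n up a * Rneg n (a - 1) (b + 1) (k + 1)
      + T (2 * ((n : ℤ) - 1 - 2 * a)) * (qint ((n : ℤ) - (b + 1)) * Rneg n a b k) := by
  refine mul_right_cancel₀ (qint_ne_zero (by omega : (k : ℤ) + 1 ≠ 0)) ?_
  rw [add_mul, add_mul, eCoef_mul_Rneg]
  have h1 := qbinom_succ_mul (a + k) k
  have h2 := qfalling_shift ((n : ℤ) - (b + 1)) k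
  have h3 := qfalling_succ ((n : ℤ) + k - (b + 1)) k
  set e : ℤ := ((n : ℤ) - 1 - 2 * a - 2 * k) * (n - 1 - 2 * (b + 1) + 2 * k + 2) + (k + 1) * k
    with he
  have h4 := qint_exchange_T e ((n : ℤ) - 1 - 2 * a) a k
  simp only [Rneg]
  push_cast
  rw [show a + (k + 1) = a + k + 1 by ring]
  rw [show (n : ℤ) - (b + 1) + k = n + k - (b + 1) by ring] at *
  rw [show (n : ℤ) - (b + 1) - 1 + k = n + k - (b + 1) - 1 by ring] at h2
  rw [show (n : ℤ) - 1 + (k + 1) - (b + 1) = n + k - (b + 1) by ring,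
    show (n : ℤ) - 1 + k - (b + 1) = n + k - (b + 1) - 1 by ring,
    show (n : ℤ) - 1 + k - b = n + k - (b + 1) by ring]
  rw [show (n : ℤ) - 1 - 2 * a + a + 1 = n - a by ring,
    show (n : ℤ) - 1 - 2 * a + a - k = n - a - k - 1 by ring] at h4
  push_cast at h1
  have t1 : (T (((n : ℤ) - 1 - 2 * a - 2 * (k + 1)) * (n - 1 - 2 * (b + 1) + 2 * (k + 1)) +
      (k + 1) * (k + 1 - 1)) : ℤ[T;T⁻¹]) * T (2 * ((n : ℤ) - 1 - 2 * (b - k))) = T e := by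
    rw [he, ← T_add]; ring_nf
  have t2 : (T (((n : ℤ) - 1 - 2 * a - 2 * k) * (n - 1 - 2 * (b + 1) + 2 * k) + k * (k - 1)) :
      ℤ[T;T⁻¹]) = T (e - (2 * ((n : ℤ) - 1 - 2 * a) - 2 * k)) := by
    rw [he]; ring_nf
  have t3 : (T (2 * ((n : ℤ) - 1 - 2 * a)) : ℤ[T;T⁻¹]) *
      T (((n : ℤ) - 1 - 2 * a - 2 * k) * (n - 1 - 2 * b + 2 * k) + k * (k - 1)) =
      T (e + (2 * ((n : ℤ) - 1 - 2 * a) - 2 * k)) := by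
    rw [he, ← T_add]; ring_nf
  have t4 : (T (((n : ℤ) - 1 - 2 * a - 2 * k) * (n - 1 - 2 * (b + 1) + 2 * k + 2) + (k + 1) * k) :
      ℤ[T;T⁻¹]) = T e := by rw [he]
  rw [t2]
  generalize qfalling ((n : ℤ) + k - (b + 1)) (k + 1) = F at *
  generalize qfalling ((n : ℤ) + k - (b + 1) - 1) k = G at *
  generalize qfalling ((n : ℤ) + k - (b + 1)) k = H at *
  generalize qint ((n : ℤ) + k - (b + 1)) = M at *
  generalize qint ((n : ℤ) - a - k - 1) = N at *
  linear_combination (T e * F * N) * h1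
    + (qbinom (a + k + 1) (k + 1) * F * N * qint (k + 1)) * t1
    - (qbinom (a + k) k * qint (k + 1) * H * qint (n - (b + 1))) * t3
    - (qbinom (a + k) k * qint (k + 1) *
        T (e + (2 * ((n : ℤ) - 1 - 2 * a) - 2 * k))) * h2
    - (qbinom (a + k) k * G * M) * h4
    - (T e * qbinom (a + k) k *
        (qint (n - a) * qint a - qint (a + k + 1) * N)) * h3

/-- In the commutation relation a fixed pair of output colors arises from angle `k` when `E` acts on
one strand and from angle `k + 1` when it acts on the other. The sums are therefore compared after a
shift of one index, at the price of two boundary conditions. -/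
theorem sum_range_exchange {R : Type*} [CommRing R] (n : ℕ) (f₁ f₂ g₁ g₂ : ℕ → R)
    (h : ∀ k, f₁ (k + 1) + f₂ k = g₁ k + g₂ (k + 1)) (h0 : f₁ 0 = g₂ 0) (hn : f₁ n = g₂ n) :
    ∑ k ∈ Finset.range n, (f₁ k + f₂ k) = ∑ k ∈ Finset.range n, (g₁ k + g₂ k) := by
  have h1 := Finset.sum_range_succ' f₁ n
  have h2 := Finset.sum_range_succ' g₂ n
  rw [Finset.sum_range_succ] at h1 h2
  have h3 : ∑ k ∈ Finset.range n, (f₁ (k + 1) + f₂ k)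
      = ∑ k ∈ Finset.range n, (g₁ k + g₂ (k + 1)) := Finset.sum_congr rfl fun k _ => h k
  rw [Finset.sum_add_distrib, Finset.sum_add_distrib] at h3 ⊢
  linear_combination h1 - h2 + h3 + h0 - hn

theorem pieceAct_eAct_posCrossing (n : ℕ) (v : List ℕ → ℤ[T;T⁻¹]) (a b : ℕ) (ha : a < n)
    (hb : b < n) :
    pieceAct n .posCrossing (eAct n [up, up] v) [a, b] =
      eAct n [up, up] (pieceAct n .posCrossing v) [a, b] := by
  have e0 := eCoef_up_zero n
  simp only [pieceAct, eAct, mul_zero, add_zero, pieceOut, pieceWt, shift, Finset.mul_sum,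
    mul_add, ← Finset.sum_add_distrib]
  refine sum_range_exchange n
    (fun k => posWt n a b k * (eCoef n up (b + k) * v [b + k - 1, a - k]))
    (fun k => posWt n a b k *
      (T (2 * wexp n up (b + k)) * (eCoef n up (a - k) * v [b + k, a - k - 1])))
    _ _ (fun k => ?_) ?_ ?_
  · rcases le_or_gt a k with hk | hk
    · rw [posWt_neg (by omega), posWt_neg (k := k + 1) (by omega), Nat.sub_eq_zero_of_le hk, e0]
      -- By truncated subtraction this is compatible with `a ≤ k` only for `a = 0`, where the
      -- coefficient of `E` vanishes.
      by_cases h : k ≤ a - 1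
      · obtain rfl : a = 0 := by omega
        simp [e0]
      · rw [posWt_neg (a := a - 1) (by omega)]
        simp
    · obtain ⟨a, rfl⟩ : ∃ a', a = a' + 1 := ⟨a - 1, by omega⟩
      rw [show a + 1 - (k + 1) = a - k by omega, show a + 1 - k - 1 = a - k by omega,
        Nat.add_sub_cancel, show b + (k + 1) - 1 = b + k by omega]
      have hx := Rpos_exchange n a b k
      by_cases hbk : b + k < n
      · have h1 : posWt n (a + 1) b (k + 1) * eCoef n up (b + (k + 1)) =
            Rpos n (a + 1) b (k + 1) * qint ((n : ℤ) - b - k - 1) := by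
          rw [eCoef_up_of_pos (by omega)]
          push_cast
          rw [show (n : ℤ) - (b + (k + 1)) = n - b - k - 1 by ring]
          -- If `b + k + 1 = n`, the truncated weight differs from `Rpos`, but the coefficient of
          -- `E` is `{0} = 0`.
          by_cases hc : b + (k + 1) < n
          · rw [posWt_pos (by omega)]
          · rw [show (n : ℤ) - b - k - 1 = 0 by omega, qint_zero, mul_zero, mul_zero]
        have h2 : eCoef n up b * posWt n (a + 1) (b - 1) (k + 1) * v [b - 1 + (k + 1), a - k] =
            eCoef n up b * Rpos n (a + 1) (b - 1) (k + 1) * v [b + k, a - k] := by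
          rcases Nat.eq_zero_or_pos b with rfl | hb
          · simp [e0]
          · rw [posWt_pos (by omega), show b - 1 + (k + 1) = b + k by omega]
        rw [posWt_pos (k := k) (by omega), posWt_pos (a := a) (by omega),
          eCoef_up_of_pos (by omega : 0 < a + 1 - k), eCoef_up_of_pos (Nat.succ_pos a)]
        simp only [wexp]
        rw [Nat.cast_sub (by omega)]
        push_cast
        rw [show (n : ℤ) - (a + 1 - k) = n - (a + 1) + k by ring]
        linear_combination v [b + k, a - k] * h1 + v [b + k, a - k] * hx
          - T (2 * ((n : ℤ) - 1 - 2 * (a + 1))) * h2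
      · rw [posWt_neg (by omega), posWt_neg (by omega), posWt_neg (a := a) (by omega)]
        rcases Nat.eq_zero_or_pos b with rfl | hb
        · simp [e0]
        · rw [posWt_neg (by omega)]
          simp
  · simp only [add_zero, Nat.sub_zero]
    rcases Nat.eq_zero_or_pos b with rfl | hb0
    · simp [e0]
    · rw [posWt_pos (by omega), posWt_pos (by omega)]
      obtain ⟨b, rfl⟩ : ∃ b', b = b' + 1 := ⟨b - 1, by omega⟩
      have : Rpos n a b 0 = T (-(2 * wexp n up a)) * Rpos n a (b + 1) 0 := by
        simp only [Rpos, wexp, qbinom, qfalling, Finset.range_zero, Finset.prod_empty, pow_zero,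
          one_mul, mul_one, ← T_add]
        congr 1
        push_cast
        ring
      have h0 : (T (2 * wexp n up a) : ℤ[T;T⁻¹]) * T (-(2 * wexp n up a)) = 1 := by
        rw [← T_add, add_neg_cancel, T_zero]
      rw [Nat.add_sub_cancel, this]
      linear_combination (-(Rpos n a (b + 1) 0 * eCoef n up (b + 1) * v [b, a])) * h0
  · rw [posWt_neg (by omega), posWt_neg (by omega)]
    simp

theorem pieceAct_eAct_negCrossing (n : ℕ) (v : List ℕ → ℤ[T;T⁻¹]) (a b : ℕ) (ha : a < n)
    (hb : b < n) :
    pieceAct n .negCrossing (eAct n [up, up] v) [a, b] =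
      eAct n [up, up] (pieceAct n .negCrossing v) [a, b] := by
  have e0 := eCoef_up_zero n
  simp only [pieceAct, eAct, mul_zero, add_zero, pieceOut, pieceWt, shift, Finset.mul_sum,
    mul_add, ← Finset.sum_add_distrib]
  -- For a negative crossing the term whose index is shifted is the one in which `E` acts on the
  -- right strand, so the summands are swapped.
  rw [Finset.sum_congr rfl fun k _ => add_comm _ _,
    Finset.sum_congr (s₁ := Finset.range n) rfl fun k _ => add_comm (eCoef n up a * _) _]
  refine sum_range_exchange n
    (fun k => negWt n a b k *
      (T (2 * wexp n up (b - k)) * (eCoef n up (a + k) * v [b - k, a + k - 1])))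
    (fun k => negWt n a b k * (eCoef n up (b - k) * v [b - k - 1, a + k]))
    _ _ (fun k => ?_) ?_ ?_
  · rcases le_or_gt b k with hk | hk
    · rw [negWt_neg (by omega), negWt_neg (k := k + 1) (by omega), Nat.sub_eq_zero_of_le hk, e0]
      by_cases h : k ≤ b - 1
      · obtain rfl : b = 0 := by omega
        simp [e0]
      · rw [negWt_neg (b := b - 1) (by omega)]
        simp
    · obtain ⟨b, rfl⟩ : ∃ b', b = b' + 1 := ⟨b - 1, by omega⟩
      rw [show b + 1 - (k + 1) = b - k by omega, show b + 1 - k - 1 = b - k by omega,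
        Nat.add_sub_cancel, show a + (k + 1) - 1 = a + k by omega]
      have hx := Rneg_exchange n a b k
      by_cases hak : a + k < n
      · have h1 : negWt n a (b + 1) (k + 1) * eCoef n up (a + (k + 1)) =
            Rneg n a (b + 1) (k + 1) * qint ((n : ℤ) - a - k - 1) := by
          rw [eCoef_up_of_pos (by omega)]
          push_cast
          rw [show (n : ℤ) - (a + (k + 1)) = n - a - k - 1 by ring]
          by_cases hc : a + (k + 1) < n
          · rw [negWt_pos (by omega)]
          · rw [show (n : ℤ) - a - k - 1 = 0 by omega, qint_zero, mul_zero, mul_zero]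
        have h2 : eCoef n up a * negWt n (a - 1) (b + 1) (k + 1) * v [b - k, a - 1 + (k + 1)] =
            eCoef n up a * Rneg n (a - 1) (b + 1) (k + 1) * v [b - k, a + k] := by
          rcases Nat.eq_zero_or_pos a with rfl | ha
          · simp [e0]
          · rw [negWt_pos (by omega), show a - 1 + (k + 1) = a + k by omega]
        rw [negWt_pos (k := k) (by omega), negWt_pos (b := b) (by omega),
          eCoef_up_of_pos (by omega : 0 < b + 1 - k), eCoef_up_of_pos (Nat.succ_pos b)]
        simp only [wexp]
        rw [Nat.cast_sub (by omega), Nat.cast_sub (by omega)]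
        push_cast
        rw [show (n : ℤ) - (b + 1 - k) = n - (b + 1) + k by ring]
        linear_combination T (2 * ((n : ℤ) - 1 - 2 * (b - k))) * v [b - k, a + k] * h1
          + v [b - k, a + k] * hx - h2
      · rw [negWt_neg (by omega), negWt_neg (by omega), negWt_neg (b := b) (by omega)]
        rcases Nat.eq_zero_or_pos a with rfl | ha
        · simp [e0]
        · rw [negWt_neg (by omega)]
          simp
  · simp only [add_zero, Nat.sub_zero]
    rcases Nat.eq_zero_or_pos a with rfl | ha0
    · simp [e0]
    · rw [negWt_pos (by omega), negWt_pos (by omega)]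
      obtain ⟨a, rfl⟩ : ∃ a', a = a' + 1 := ⟨a - 1, by omega⟩
      have : Rneg n a b 0 = T (2 * wexp n up b) * Rneg n (a + 1) b 0 := by
        simp only [Rneg, wexp, qbinom, qfalling, Finset.range_zero, Finset.prod_empty,
          mul_one, ← T_add]
        congr 1
        push_cast
        ring
      rw [Nat.add_sub_cancel, this]
      ring
  · rw [negWt_neg (by omega), negWt_neg (by omega)]
    simp

/-! ### Commutation of the cups and caps with `E` -/

theorem T_mul_T_neg (e : ℤ) : (T e : ℤ[T;T⁻¹]) * T (-e) = 1 := by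
  rw [← T_add, add_neg_cancel, T_zero]

/-- A downward strand carries the dual module. This relation between the actions on the two kinds of
strands makes the terms at cups and caps cancel. -/
theorem T_mul_eCoef_down (n a : ℕ) :
    T (2 * ((n : ℤ) - 1 - 2 * a)) * eCoef n down a = -eCoef n up (a + 1) := by
  rw [eCoef_up_of_pos (Nat.succ_pos a), eCoef, mul_neg, ← mul_assoc, T_mul_T_neg, one_mul]
  push_cast
  rw [show (n : ℤ) - 1 - a = n - (a + 1) by ring]

theorem eCoef_up_self (n : ℕ) : eCoef n up n = 0 := by
  simp [eCoef, qint_zero]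

theorem sum_range_zero_ite {R : Type*} [CommRing R] {n : ℕ} (hn : 0 < n) (p : Prop) [Decidable p]
    (x y : R) :
    ∑ k ∈ Finset.range n, (if k = 0 ∧ p then x else 0) * y = if p then x * y else 0 := by
  rw [Finset.sum_eq_single_of_mem 0 (Finset.mem_range.mpr hn)]
  · simp
  · intro k _ hk
    simp [hk]

theorem pieceAct_capUD {n : ℕ} (hn : 0 < n) (v : List ℕ → ℤ[T;T⁻¹]) (a b : ℕ) :
    pieceAct n .capUD v [a, b] =
      if a = b then T (-(2 * ((n : ℤ) - 1 - 2 * a))) * v [] else 0 := by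
  have h := sum_range_zero_ite hn (a = b) (T (-(2 * ((n : ℤ) - 1 - 2 * a)))) (v [])
  exact h

theorem pieceAct_capDU {n : ℕ} (hn : 0 < n) (v : List ℕ → ℤ[T;T⁻¹]) (a b : ℕ) :
    pieceAct n .capDU v [a, b] = if a = b then v [] else 0 := by
  have h := sum_range_zero_ite (R := ℤ[T;T⁻¹]) hn (a = b) 1 (v [])
  rw [one_mul] at h
  exact h

/-- A piece commutes with the action of `E`. -/
theorem pieceAct_eAct (n : ℕ) (p : Piece) (v : List ℕ → ℤ[T;T⁻¹]) (m : List ℕ)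
    (hm : m.length = p.bot.length) (hlt : ∀ x ∈ m, x < n) :
    pieceAct n p (eAct n p.top v) m = eAct n p.bot (pieceAct n p v) m := by
  cases p
  case posCrossing =>
    obtain ⟨a, b, rfl⟩ := List.length_eq_two.mp hm
    exact pieceAct_eAct_posCrossing n v a b (hlt a (by simp)) (hlt b (by simp))
  case negCrossing =>
    obtain ⟨a, b, rfl⟩ := List.length_eq_two.mp hm
    exact pieceAct_eAct_negCrossing n v a b (hlt a (by simp)) (hlt b (by simp))
  case cupUD =>
    obtain rfl := List.length_eq_zero_iff.mp hm
    simp only [pieceAct, Piece.top, Piece.bot, eAct, pieceWt, pieceOut, shift, wexp]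
    -- The two terms of the coproduct telescope over the color of the cup. The boundary terms
    -- contain the coefficients of `E` at the colors `0` and `n`, which vanish.
    rw [Finset.sum_congr rfl (g := fun k => eCoef n up k * v [k - 1, k]
        - eCoef n up (k + 1) * v [k + 1 - 1, k + 1]) fun k _ => ?_, Finset.sum_range_sub',
      eCoef_up_zero, eCoef_up_self]
    · simp
    · rw [Nat.add_sub_cancel]
      linear_combination v [k, k + 1] * T_mul_eCoef_down n k
  case cupDU =>
    obtain rfl := List.length_eq_zero_iff.mp hm
    simp only [pieceAct, Piece.top, Piece.bot, eAct, pieceWt, pieceOut, shift, wexp]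
    rw [Finset.sum_congr rfl (g := fun k => eCoef n up k * v [k, k - 1]
        - eCoef n up (k + 1) * v [k + 1, k + 1 - 1]) fun k _ => ?_, Finset.sum_range_sub',
      eCoef_up_zero, eCoef_up_self]
    · simp
    · rw [Nat.add_sub_cancel]
      have h := T_mul_T_neg (2 * ((n : ℤ) - 1 - 2 * k))
      rw [show 2 * -((n : ℤ) - 1 - 2 * k) = -(2 * ((n : ℤ) - 1 - 2 * k)) by ring]
      linear_combination v [k + 1, k] * T_mul_eCoef_down n k + eCoef n up k * v [k, k - 1] * h
  case capUD =>
    obtain ⟨a, b, rfl⟩ := List.length_eq_two.mp hm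
    have hn : 0 < n := (Nat.zero_le _).trans_lt (hlt a (by simp))
    have h0 : pieceAct n .capUD (eAct n [] v) [a, b] = 0 := by simp [pieceAct, eAct]
    rw [Piece.top, h0]
    simp only [Piece.bot, eAct, pieceAct_capUD hn, shift, wexp]
    -- Since `E` kills the trivial module, the right side has to vanish. Its two terms are nonzero
    -- only for these neighboring colors, and there they cancel.
    by_cases h : a = b + 1
    · subst h
      rw [if_pos (Nat.add_sub_cancel b 1), if_pos rfl]
      have h := T_mul_T_neg (2 * ((n : ℤ) - 1 - 2 * b))
      have h2 := T_mul_eCoef_down n b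
      have h3 := T_mul_T_neg (2 * ((n : ℤ) - 1 - 2 * (b + 1 : ℕ)))
      rw [show 2 * -((n : ℤ) - 1 - 2 * b) = -(2 * ((n : ℤ) - 1 - 2 * b)) by ring]
      rw [Nat.add_sub_cancel]
      linear_combination -T (-(2 * ((n : ℤ) - 1 - 2 * b))) * v [] * h2
        + eCoef n down b * v [] * h - eCoef n down b * v [] * h3
    · rw [if_neg (c := a = b + 1) h]
      rcases Nat.eq_zero_or_pos a with rfl | ha
      · simp [eCoef_up_zero]
      · rw [if_neg (by omega)]
        simp
  case capDU =>
    obtain ⟨a, b, rfl⟩ := List.length_eq_two.mp hm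
    have hn : 0 < n := (Nat.zero_le _).trans_lt (hlt a (by simp))
    have h0 : pieceAct n .capDU (eAct n [] v) [a, b] = 0 := by simp [pieceAct, eAct]
    rw [Piece.top, h0]
    simp only [Piece.bot, eAct, pieceAct_capDU hn, shift, wexp]
    by_cases h : b = a + 1
    · subst h
      rw [if_pos (Nat.add_sub_cancel a 1).symm, if_pos rfl]
      have h2 := T_mul_eCoef_down n a
      have h := T_mul_T_neg (2 * ((n : ℤ) - 1 - 2 * a))
      rw [show 2 * -((n : ℤ) - 1 - 2 * a) = -(2 * ((n : ℤ) - 1 - 2 * a)) by ring]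
      linear_combination -T (-(2 * ((n : ℤ) - 1 - 2 * a))) * v [] * h2 + eCoef n down a * v [] * h
    · rw [if_neg (c := a + 1 = b) (by omega)]
      rcases Nat.eq_zero_or_pos b with rfl | hb
      · simp [eCoef_up_zero]
      · rw [if_neg (by omega)]
        simp

/-! ### The operator of a word -/

/-- `i` is a coloring of the strands `s` by elements of `{0, …, n - 1}`. -/
def Valid (n : ℕ) (s : List Strand) (i : List ℕ) : Prop :=
  i.length = s.length ∧ ∀ x ∈ i, x < n

/-- The colors at the bottom of the piece of a slice. -/
def Slice.mid (s : Slice) (i : List ℕ) : List ℕ := (i.drop s.left).take s.piece.bot.length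

/-- The colors at the top of a slice whose piece has variable `k`. -/
def sliceOut (s : Slice) (k : ℕ) (i : List ℕ) : List ℕ :=
  i.take s.left ++ pieceOut s.piece k (s.mid i) ++ i.drop (s.left + s.piece.bot.length)

/-- The operator of a slice, on functions of the colors at its top. -/
def sliceAct (n : ℕ) (s : Slice) (v : List ℕ → ℤ[T;T⁻¹]) (i : List ℕ) : ℤ[T;T⁻¹] :=
  ∑ k ∈ Finset.range n, pieceWt n s.piece k (s.mid i) * v (sliceOut s k i)

/-- The operator of a word, on functions of the colors at its top. -/
def act (n : ℕ) : List Slice → (List ℕ → ℤ[T;T⁻¹]) → List ℕ → ℤ[T;T⁻¹]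
  | [], u => u
  | s :: w, u => sliceAct n s (act n w u)

theorem act_append (n : ℕ) (w₁ w₂ : List Slice) (u : List ℕ → ℤ[T;T⁻¹]) :
    act n (w₁ ++ w₂) u = act n w₁ (act n w₂ u) := by
  induction w₁ with
  | nil => rfl
  | cons s w ih => rw [List.cons_append, act, act, ih]

theorem sum_range_ite_le {R : Type*} [CommRing R] (n : ℕ) (p : ℕ → Prop) [DecidablePred p]
    (f g : ℕ → R) :
    ∑ k ∈ Finset.range n with p k, f k * g k =
      ∑ k ∈ Finset.range n, (if p k then f k else 0) * g k := by
  rw [Finset.sum_filter]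
  exact Finset.sum_congr rfl fun k _ => by split_ifs <;> simp

/-- Positivity of `n` matters for caps: they have the dummy variable `0`, which must lie in the
range of summation. -/
theorem stateSum_eq_act {n : ℕ} (hn : 0 < n) (w : List Slice) (i j : List ℕ) :
    stateSum n w i j = act n w (fun i' => if i' = j then 1 else 0) i := by
  induction w generalizing i with
  | nil => simp [stateSum, act]
  | cons s w ih =>
    obtain ⟨l, p⟩ := s
    rw [act, sliceAct]
    simp only [← ih]
    cases p
    case cupUD =>
      simp [stateSum, Slice.mid, sliceOut, Piece.bot, pieceWt, pieceOut]
    case cupDU =>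
      simp [stateSum, Slice.mid, sliceOut, Piece.bot, pieceWt, pieceOut]
    all_goals
      simp only [stateSum, Slice.mid, sliceOut, Piece.bot, List.length_cons, List.length_nil,
        zero_add, Nat.reduceAdd, ← List.drop_drop]
      rcases List.drop l i with _ | ⟨a, _ | ⟨b, r⟩⟩
      · simp [pieceWt]
      · simp [pieceWt]
    · simp [pieceWt, pieceOut, posWt, sum_range_ite_le]
    · simp [pieceWt, pieceOut, negWt, sum_range_ite_le]
    · simpa [pieceWt, pieceOut] using
        (sum_range_zero_ite hn (a = b) (T (-(2 * ((n : ℤ) - 1 - 2 * a))) : ℤ[T;T⁻¹]) _).symm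
    · simpa [pieceWt, pieceOut] using
        (sum_range_zero_ite hn (a = b) (1 : ℤ[T;T⁻¹]) _).symm

theorem mid_append (l m r : List ℕ) (p : Piece) (hm : m.length = p.bot.length) :
    Slice.mid ⟨l.length, p⟩ (l ++ m ++ r) = m := by
  simp [Slice.mid, ← hm]

theorem sliceOut_append (l m r : List ℕ) (p : Piece) (hm : m.length = p.bot.length) (k : ℕ) :
    sliceOut ⟨l.length, p⟩ k (l ++ m ++ r) = l ++ pieceOut p k m ++ r := by
  rw [sliceOut, mid_append l m r p hm]
  simp [← hm]

theorem sliceAct_append (n : ℕ) (v : List ℕ → ℤ[T;T⁻¹]) (l m r : List ℕ) (p : Piece)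
    (hm : m.length = p.bot.length) :
    sliceAct n ⟨l.length, p⟩ v (l ++ m ++ r) = pieceAct n p (fun m' => v (l ++ m' ++ r)) m := by
  simp only [sliceAct, pieceAct, mid_append l m r p hm, sliceOut_append l m r p hm]

theorem Valid.append {n : ℕ} {s t : List Strand} {i j : List ℕ} (hi : Valid n s i)
    (hj : Valid n t j) : Valid n (s ++ t) (i ++ j) :=
  ⟨by simp [hi.1, hj.1], fun x hx => (List.mem_append.mp hx).elim (hi.2 x) (hj.2 x)⟩

theorem Valid.exists_append {n : ℕ} {s t : List Strand} {i : List ℕ} (h : Valid n (s ++ t) i) :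
    ∃ i₁ i₂, i = i₁ ++ i₂ ∧ Valid n s i₁ ∧ Valid n t i₂ := by
  have hl := h.1
  rw [List.length_append] at hl
  refine ⟨i.take s.length, i.drop s.length, (List.take_append_drop _ _).symm, ⟨?_, ?_⟩, ?_, ?_⟩
  · simp [hl]
  · exact fun x hx => h.2 x (List.mem_of_mem_take hx)
  · simp [hl]
  · exact fun x hx => h.2 x (List.mem_of_mem_drop hx)

/-- The colors at the top of a piece in a state of nonzero weight. -/
theorem pieceOut_valid {n : ℕ} {p : Piece} {k : ℕ} {m : List ℕ} (hk : k < n)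
    (hm : Valid n p.bot m) (hw : pieceWt n p k m ≠ 0) :
    Valid n p.top (pieceOut p k m) ∧ wexps n p.top (pieceOut p k m) = wexps n p.bot m := by
  obtain ⟨hm, hlt⟩ := hm
  cases p
  case cupUD =>
    obtain rfl := List.length_eq_zero_iff.mp hm
    simp [Valid, pieceOut, Piece.top, Piece.bot, wexps, wexp, hk]
  case cupDU =>
    obtain rfl := List.length_eq_zero_iff.mp hm
    simp [Valid, pieceOut, Piece.top, Piece.bot, wexps, wexp, hk]
  all_goals obtain ⟨a, b, rfl⟩ := List.length_eq_two.mp hm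
  case posCrossing =>
    have h : k ≤ a ∧ b + k < n := by
      by_contra h
      exact hw (posWt_neg h)
    have ha := hlt a (by simp)
    simp [Valid, pieceOut, Piece.top, Piece.bot, wexps, wexp, Nat.cast_sub h.1]
    omega
  case negCrossing =>
    have h : k ≤ b ∧ a + k < n := by
      by_contra h
      exact hw (negWt_neg h)
    have ha := hlt b (by simp)
    simp [Valid, pieceOut, Piece.top, Piece.bot, wexps, wexp, Nat.cast_sub h.1]
    omega
  case capUD =>
    have h : a = b := by
      by_contra h
      exact hw (if_neg (by simp [h]))
    simp [Valid, pieceOut, Piece.top, Piece.bot, wexps, wexp, h]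
  case capDU =>
    have h : a = b := by
      by_contra h
      exact hw (if_neg (by simp [h]))
    simp [Valid, pieceOut, Piece.top, Piece.bot, wexps, wexp, h]

theorem wexps_append (n : ℕ) (s t : List Strand) (i j : List ℕ) (hi : i.length = s.length) :
    wexps n (s ++ t) (i ++ j) = wexps n s i + wexps n t j := by
  induction s generalizing i with
  | nil =>
    obtain rfl := List.length_eq_zero_iff.mp hi
    simp [wexps]
  | cons a s ih =>
    obtain ⟨x, i, rfl⟩ := List.exists_cons_of_length_eq_add_one hi
    simp only [List.cons_append, wexps]
    rw [ih i (by simpa using hi), add_assoc]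

theorem sliceOut_valid {n : ℕ} {L R : List Strand} {p : Piece} {k : ℕ} {i : List ℕ} (hk : k < n)
    (hi : Valid n (L ++ p.bot ++ R) i)
    (hw : pieceWt n p k (Slice.mid ⟨L.length, p⟩ i) ≠ 0) :
    Valid n (L ++ p.top ++ R) (sliceOut ⟨L.length, p⟩ k i) ∧
      wexps n (L ++ p.top ++ R) (sliceOut ⟨L.length, p⟩ k i) = wexps n (L ++ p.bot ++ R) i := by
  obtain ⟨i', r, rfl, hi', hr⟩ := hi.exists_append
  obtain ⟨l, m, rfl, hl, hm⟩ := hi'.exists_append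
  rw [← hl.1, mid_append l m r p hm.1] at hw
  rw [← hl.1, sliceOut_append l m r p hm.1]
  obtain ⟨h1, h2⟩ := pieceOut_valid hk hm hw
  refine ⟨(hl.append h1).append hr, ?_⟩
  rw [wexps_append _ _ _ _ _ (hl.append h1).1, wexps_append _ _ _ _ _ hl.1,
    wexps_append _ _ _ _ _ (hl.append hm).1, wexps_append _ _ _ _ _ hl.1, h2]

theorem sliceAct_congr {n : ℕ} {L R : List Strand} {p : Piece} {v v' : List ℕ → ℤ[T;T⁻¹]}
    (h : ∀ i, Valid n (L ++ p.top ++ R) i → v i = v' i) {i : List ℕ}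
    (hi : Valid n (L ++ p.bot ++ R) i) :
    sliceAct n ⟨L.length, p⟩ v i = sliceAct n ⟨L.length, p⟩ v' i := by
  refine Finset.sum_congr rfl fun k hk => ?_
  by_cases hw : pieceWt n p k (Slice.mid ⟨L.length, p⟩ i) = 0
  · simp only [hw, zero_mul]
  · rw [h _ (sliceOut_valid (Finset.mem_range.mp hk) hi hw).1]

theorem act_congr {n : ℕ} {w : List Slice} {s t : List Strand} (hw : IsTangle w s t)
    {u u' : List ℕ → ℤ[T;T⁻¹]} (h : ∀ i, Valid n t i → u i = u' i) :
    ∀ i, Valid n s i → act n w u i = act n w u' i := by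
  induction hw with
  | nil s => exact h
  | cons L R t p w _ ih => exact fun i hi => sliceAct_congr (ih h) hi

/-! ### Equivariance -/

theorem eAct_congr {n : ℕ} (s : List Strand) {v v' : List ℕ → ℤ[T;T⁻¹]} {i : List ℕ}
    (h : ∀ j, j.length = i.length → v j = v' j) : eAct n s v i = eAct n s v' i := by
  induction s generalizing v v' i with
  | nil => simp [eAct]
  | cons a s ih =>
    cases i with
    | nil => simp [eAct]
    | cons x i =>
      simp only [eAct]
      rw [h _ (by simp), ih fun j hj => h _ (by simp [hj])]

theorem eAct_sum {n : ℕ} (s : List Strand) {ι : Type*} (S : Finset ι) (c : ι → ℤ[T;T⁻¹])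
    (v : ι → List ℕ → ℤ[T;T⁻¹]) (i : List ℕ) :
    eAct n s (fun j => ∑ k ∈ S, c k * v k j) i = ∑ k ∈ S, c k * eAct n s (v k) i := by
  induction s generalizing v i with
  | nil => simp [eAct]
  | cons a s ih =>
    cases i with
    | nil => simp [eAct]
    | cons x i =>
      simp only [eAct]
      rw [ih, Finset.mul_sum, Finset.mul_sum, ← Finset.sum_add_distrib]
      exact Finset.sum_congr rfl fun k _ => by ring

theorem eAct_mul_left {n : ℕ} (s : List Strand) (c : ℤ[T;T⁻¹])
    (v : List ℕ → ℤ[T;T⁻¹]) (i : List ℕ) :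
    eAct n s (fun j => c * v j) i = c * eAct n s v i := by
  simpa using eAct_sum (n := n) s {()} (fun _ => c) (fun _ => v) i

theorem eAct_append (n : ℕ) (s t : List Strand) (v : List ℕ → ℤ[T;T⁻¹]) (i j : List ℕ)
    (hi : i.length = s.length) :
    eAct n (s ++ t) v (i ++ j) = eAct n s (fun x => v (x ++ j)) i
      + T (2 * wexps n s i) * eAct n t (fun y => v (i ++ y)) j := by
  induction s generalizing i v with
  | nil =>
    obtain rfl := List.length_eq_zero_iff.mp hi
    simp [eAct, wexps]
  | cons a s ih =>
    obtain ⟨x, i, rfl⟩ := List.exists_cons_of_length_eq_add_one hi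
    simp only [List.cons_append, eAct, wexps]
    rw [ih _ i (by simpa using hi), mul_add, mul_add, T_add]
    ring

theorem pieceAct_mul_left (n : ℕ) (p : Piece) (c : ℤ[T;T⁻¹]) (v : List ℕ → ℤ[T;T⁻¹])
    (m : List ℕ) : pieceAct n p (fun m' => c * v m') m = c * pieceAct n p v m := by
  simp only [pieceAct, Finset.mul_sum, mul_left_comm]

theorem pieceAct_add (n : ℕ) (p : Piece) (v v' : List ℕ → ℤ[T;T⁻¹])
    (m : List ℕ) : pieceAct n p (fun m' => v m' + v' m') m = pieceAct n p v m + pieceAct n p v' m := by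
  simp only [pieceAct, mul_add, Finset.sum_add_distrib]

theorem pieceAct_congr {n : ℕ} {p : Piece} {v v' : List ℕ → ℤ[T;T⁻¹]} {m : List ℕ}
    (hm : Valid n p.bot m)
    (h : ∀ m', Valid n p.top m' → wexps n p.top m' = wexps n p.bot m → v m' = v' m') :
    pieceAct n p v m = pieceAct n p v' m := by
  refine Finset.sum_congr rfl fun k hk => ?_
  by_cases hw : pieceWt n p k m = 0
  · simp only [hw, zero_mul]
  · have h1 := pieceOut_valid (Finset.mem_range.mp hk) hm hw
    rw [h _ h1.1 h1.2]

theorem eAct_pieceAct_comm (n : ℕ) (p : Piece) (s : List Strand)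
    (v : List ℕ → List ℕ → ℤ[T;T⁻¹]) (i m : List ℕ) :
    pieceAct n p (fun m' => eAct n s (v m') i) m =
      eAct n s (fun x => pieceAct n p (fun m' => v m' x) m) i := by
  simp only [pieceAct]
  rw [eAct_sum s _ (fun k => pieceWt n p k m) (fun k => v (pieceOut p k m))]

/-- The coproduct splits `E` into its actions on `L`, on the piece and on `R`. Those on `L` and `R`
involve other tensor factors, the one on the piece commutes by `pieceAct_eAct`, and the factor `K`
of the piece in front of `R` passes because a piece conserves weight. -/
theorem sliceAct_eAct (n : ℕ) (L R : List Strand) (p : Piece) (v : List ℕ → ℤ[T;T⁻¹])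
    (i : List ℕ) (hi : Valid n (L ++ p.bot ++ R) i) :
    sliceAct n ⟨L.length, p⟩ (eAct n (L ++ p.top ++ R) v) i =
      eAct n (L ++ p.bot ++ R) (sliceAct n ⟨L.length, p⟩ v) i := by
  obtain ⟨i', r, rfl, hi', hr⟩ := hi.exists_append
  obtain ⟨l, m, rfl, hl, hm⟩ := hi'.exists_append
  rw [← hl.1, sliceAct_append n _ l m r p hm.1, pieceAct_congr hm
    (v' := fun m' => eAct n L (fun x => v (x ++ m' ++ r)) l + (T (2 * wexps n L l) *
      (eAct n p.top (fun y => v (l ++ y ++ r)) m' + T (2 * wexps n p.bot m) *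
        eAct n R (fun z => v (l ++ m' ++ z)) r))) fun m' hm' hw => ?_]
  · rw [pieceAct_add, pieceAct_mul_left, pieceAct_add, pieceAct_mul_left, eAct_pieceAct_comm,
      eAct_pieceAct_comm, pieceAct_eAct n p _ m hm.1 hm.2,
      eAct_append n _ R _ _ _ (hl.append hm).1, eAct_append n L _ _ _ _ hl.1,
      wexps_append _ _ _ _ _ hl.1, mul_add (2 : ℤ), T_add, mul_add]
    rw [eAct_congr (n := n) L (v' := fun x => pieceAct n p (fun m' => v (x ++ m' ++ r)) m)
        (v := fun x => sliceAct n ⟨l.length, p⟩ v (x ++ m ++ r)) fun j hj => ?_,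
      eAct_congr (n := n) p.bot (v' := fun y => pieceAct n p (fun m' => v (l ++ m' ++ r)) y)
        (v := fun y => sliceAct n ⟨l.length, p⟩ v (l ++ y ++ r)) fun j hj => ?_,
      eAct_congr (n := n) R (v' := fun z => pieceAct n p (fun m' => v (l ++ m' ++ z)) m)
        (v := fun z => sliceAct n ⟨l.length, p⟩ v (l ++ m ++ z)) fun j hj => ?_]
    · ring
    · exact sliceAct_append n v l m j p hm.1
    · exact sliceAct_append n v l j r p (hj.trans hm.1)
    · rw [← hj]
      exact sliceAct_append n v j m r p hm.1
  · rw [eAct_append n _ R _ _ _ (hl.append hm').1, eAct_append n L _ _ _ _ hl.1,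
      wexps_append _ _ _ _ _ hl.1, mul_add (2 : ℤ), T_add, hw]
    ring

/-- The operator of a tangle commutes with the action of `E`. -/
theorem act_eAct {n : ℕ} {w : List Slice} {s t : List Strand} (hw : IsTangle w s t)
    (u : List ℕ → ℤ[T;T⁻¹]) :
    ∀ i, Valid n s i → act n w (eAct n t u) i = eAct n s (act n w u) i := by
  induction hw with
  | nil s => exact fun i _ => rfl
  | cons L R t p w _ ih =>
    intro i hi
    rw [act, act, ← sliceAct_eAct n L R p _ i hi]
    exact sliceAct_congr ih hi

theorem sliceAct_weight (n : ℕ) (L R : List Strand) (p : Piece) (f : ℤ → ℤ[T;T⁻¹])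
    (v : List ℕ → ℤ[T;T⁻¹]) (i : List ℕ) (hi : Valid n (L ++ p.bot ++ R) i) :
    sliceAct n ⟨L.length, p⟩ (fun j => f (wexps n (L ++ p.top ++ R) j) * v j) i =
      f (wexps n (L ++ p.bot ++ R) i) * sliceAct n ⟨L.length, p⟩ v i := by
  rw [sliceAct, sliceAct, Finset.mul_sum]
  refine Finset.sum_congr rfl fun k hk => ?_
  by_cases hw : pieceWt n p k (Slice.mid ⟨L.length, p⟩ i) = 0
  · simp only [hw, zero_mul, mul_zero]
  · rw [(sliceOut_valid (Finset.mem_range.mp hk) hi hw).2]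
    ring

/-- The operator of a tangle preserves the weight. -/
theorem act_weight {n : ℕ} {w : List Slice} {s t : List Strand} (hw : IsTangle w s t)
    (f : ℤ → ℤ[T;T⁻¹]) (u : List ℕ → ℤ[T;T⁻¹]) :
    ∀ i, Valid n s i →
      act n w (fun j => f (wexps n t j) * u j) i = f (wexps n s i) * act n w u i := by
  induction hw with
  | nil s => exact fun i _ => rfl
  | cons L R t p w _ ih =>
    intro i hi
    rw [act, act, ← sliceAct_weight n L R p f _ i hi]
    exact sliceAct_congr ih hi

/-! ### Cutting a long knot diagram at another edge -/

theorem act_sum {n : ℕ} (w : List Slice) {ι : Type*} (S : Finset ι) (c : ι → ℤ[T;T⁻¹])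
    (v : ι → List ℕ → ℤ[T;T⁻¹]) (i : List ℕ) :
    act n w (fun j => ∑ k ∈ S, c k * v k j) i = ∑ k ∈ S, c k * act n w (v k) i := by
  induction w generalizing i with
  | nil => rfl
  | cons s w ih =>
    simp only [act, sliceAct, ih, Finset.mul_sum]
    rw [Finset.sum_comm]
    exact Finset.sum_congr rfl fun k _ => Finset.sum_congr rfl fun l _ => by ring

theorem act_mul_left {n : ℕ} (w : List Slice) (c : ℤ[T;T⁻¹])
    (v : List ℕ → ℤ[T;T⁻¹]) (i : List ℕ) :
    act n w (fun j => c * v j) i = c * act n w v i := by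
  simpa using act_sum (n := n) w {()} (fun _ => c) (fun _ => v) i

/-! ### Matrix units and the raising operator -/

theorem wexp_shift {n : ℕ} {st : Strand} {a : ℕ} (h : eCoef n st a ≠ 0) :
    wexp n st (shift st a) = wexp n st a + 2 := by
  cases st
  · have : 0 < a := by
      by_contra h0
      obtain rfl : a = 0 := by omega
      exact h (eCoef_up_zero n)
    simp only [wexp, shift]
    omega
  · simp only [wexp, shift]
    push_cast
    ring

theorem shift_inj {n : ℕ} {st : Strand} {a b : ℕ} (ha : eCoef n st a ≠ 0) (hb : eCoef n st b ≠ 0)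
    (h : shift st a = shift st b) : a = b := by
  cases st
  · have h1 : a ≠ 0 := by
      rintro rfl
      exact ha (eCoef_up_zero n)
    have h2 : b ≠ 0 := by
      rintro rfl
      exact hb (eCoef_up_zero n)
    simp only [shift] at h
    omega
  · simpa [shift] using h

/-- `E` raises the weight by `2`. -/
theorem eAct_weight (n : ℕ) (s : List Strand) (f : ℤ → ℤ[T;T⁻¹]) (v : List ℕ → ℤ[T;T⁻¹])
    (i : List ℕ) :
    eAct n s (fun j => f (wexps n s j) * v j) i = f (wexps n s i + 2) * eAct n s v i := by
  induction s generalizing f v i with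
  | nil => simp [eAct]
  | cons a s ih =>
    cases i with
    | nil => simp [eAct]
    | cons x i =>
      simp only [eAct, wexps]
      rw [ih (fun e => f (wexp n a x + e))]
      by_cases h : eCoef n a x = 0
      · simp only [h]
        ring_nf
      · rw [wexp_shift h]
        ring_nf

/-- The functional `delta x` of the color at the top of a word is `1` at `[x]`. -/
def delta (x : ℕ) (i : List ℕ) : ℤ[T;T⁻¹] := if i = [x] then 1 else 0

/-- The transpose of `E` moves the functional at `x` to the one at `x + 1`; at `x = n - 1` the
coefficient is zero. -/
theorem eAct_delta {n : ℕ} (x : ℕ) (i : List ℕ) (hi : Valid n [up] i) :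
    eAct n [up] (delta x) i = eCoef n up (x + 1) * delta (x + 1) i := by
  obtain ⟨a, rfl⟩ := List.length_eq_one_iff.mp hi.1
  simp only [eAct, delta, shift, mul_zero, add_zero, List.cons.injEq, and_true]
  rcases Nat.eq_zero_or_pos a with rfl | h
  · simp [eCoef_up_zero]
  · by_cases h2 : a = x + 1
    · subst h2
      simp
    · rw [if_neg (by omega), if_neg h2]
      simp

/-- The operator that inserts the matrix unit from color `b` to color `a` at a strand with the
strands `L` to the left of it and `R` to the right of it. -/
def insertUnit (n : ℕ) (L R : List Strand) (f : ℤ → ℤ → ℤ[T;T⁻¹]) (b a : ℕ)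
    (v : List ℕ → ℤ[T;T⁻¹]) (i : List ℕ) : ℤ[T;T⁻¹] :=
  f (wexps n L (i.take L.length)) (wexps n R (i.drop (L.length + 1))) *
    if i[L.length]? = some b then v (i.take L.length ++ [a] ++ i.drop (L.length + 1)) else 0

theorem insertUnit_append {n : ℕ} {L R : List Strand} {f : ℤ → ℤ → ℤ[T;T⁻¹]} {b a : ℕ}
    {v : List ℕ → ℤ[T;T⁻¹]} {l r : List ℕ} {c : ℕ} (hl : l.length = L.length) :
    insertUnit n L R f b a v (l ++ [c] ++ r) =
      f (wexps n L l) (wexps n R r) * if c = b then v (l ++ [a] ++ r) else 0 := by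
  simp [insertUnit, ← hl]

theorem Valid.exists_insert {n : ℕ} {L R : List Strand} {st : Strand} {i : List ℕ}
    (h : Valid n (L ++ [st] ++ R) i) :
    ∃ l c r, i = l ++ [c] ++ r ∧ Valid n L l ∧ c < n ∧ Valid n R r := by
  obtain ⟨i', r, rfl, hi', hr⟩ := h.exists_append
  obtain ⟨l, m, rfl, hl, hm⟩ := hi'.exists_append
  obtain ⟨c, rfl⟩ := List.length_eq_one_iff.mp hm.1
  exact ⟨l, c, r, rfl, hl, hm.2 c (by simp), hr⟩

/-- The action of `E` on `L` cancels in the commutator. On `R` it cancels thanks to the twist by the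
inverse weight of `R`: the change of `K` on the middle strand is compensated by the weight that `E`
adds to `R`. What remains is `E` on the middle strand, with `K` of `L` in front, and this gives the
two diagonal units. -/
theorem eAct_insertUnit {n : ℕ} {L R : List Strand} {st : Strand} {a : ℕ}
    (ha : eCoef n st a ≠ 0) (v : List ℕ → ℤ[T;T⁻¹]) (i : List ℕ)
    (hi : Valid n (L ++ [st] ++ R) i) :
    eAct n (L ++ [st] ++ R) (insertUnit n L R (fun _ y => T (-(2 * y))) (shift st a) a v) i
      - insertUnit n L R (fun _ y => T (-(2 * y))) (shift st a) a
          (eAct n (L ++ [st] ++ R) v) i =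
    eCoef n st a * (insertUnit n L R (fun x y => T (2 * x - 2 * y)) a a v i
      - insertUnit n L R (fun x y => T (2 * x - 2 * y)) (shift st a) (shift st a) v i) := by
  obtain ⟨l, c, r, rfl, hl, hc, hr⟩ := hi.exists_insert
  have key (g : List ℕ → ℤ[T;T⁻¹]) (d : ℕ) : eAct n (L ++ [st] ++ R) g (l ++ [d] ++ r) =
      eAct n L (fun x => g (x ++ [d] ++ r)) l + T (2 * wexps n L l) *
        (eCoef n st d * g (l ++ [shift st d] ++ r) +
          T (2 * wexp n st d) * eAct n R (fun z => g (l ++ [d] ++ z)) r) := by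
    rw [List.append_assoc, List.append_assoc, eAct_append n L _ _ _ _ hl.1]
    simp [eAct]
  rw [insertUnit_append hl.1, insertUnit_append hl.1, insertUnit_append hl.1, key, key,
    insertUnit_append hl.1]
  rw [eAct_congr L (v' := fun x => (T (-(2 * wexps n R r)) * if c = shift st a then 1 else 0) *
        v (x ++ [a] ++ r)) fun j hj => ?_,
    eAct_congr R (v' := fun z => (if c = shift st a then 1 else 0) * (T (-(2 * wexps n R z)) *
        v (l ++ [a] ++ z))) fun j hj => ?_,
    eAct_mul_left, eAct_mul_left, eAct_weight n R (fun y => T (-(2 * y)))]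
  · have h1 : eCoef n st c * (if shift st c = shift st a then v (l ++ [a] ++ r) else 0) =
        if c = a then eCoef n st a * v (l ++ [a] ++ r) else 0 := by
      by_cases h : c = a
      · subst h
        simp
      · rw [if_neg h]
        by_cases h2 : eCoef n st c = 0
        · rw [h2, zero_mul]
        · rw [if_neg fun h3 => h (shift_inj h2 ha h3), mul_zero]
    have h2 : (T (2 * wexps n L l - 2 * wexps n R r) : ℤ[T;T⁻¹]) =
        T (2 * wexps n L l) * T (-(2 * wexps n R r)) := by rw [← T_add, sub_eq_add_neg]
    rw [h2]
    have h3 : T (2 * wexps n L l) * (eCoef n st c *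
        (T (-(2 * wexps n R r)) * if shift st c = shift st a then v (l ++ [a] ++ r) else 0)) =
        T (2 * wexps n L l) * T (-(2 * wexps n R r)) *
          if c = a then eCoef n st a * v (l ++ [a] ++ r) else 0 := by rw [← h1]; ring
    by_cases hca : c = shift st a
    · subst hca
      have h4 : (T (2 * wexp n st (shift st a)) : ℤ[T;T⁻¹]) * T (-(2 * (wexps n R r + 2))) =
          T (-(2 * wexps n R r)) * T (2 * wexp n st a) := by
        rw [wexp_shift ha, ← T_add, ← T_add]
        ring_nf
      simp only [if_true]
      rw [mul_add, h3]
      split_ifs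
      · linear_combination T (2 * wexps n L l) * eAct n R (fun z => v (l ++ [a] ++ z)) r * h4
      · linear_combination T (2 * wexps n L l) * eAct n R (fun z => v (l ++ [a] ++ z)) r * h4
    · simp only [if_neg hca]
      rw [mul_add, h3]
      split_ifs <;> ring
  · rw [insertUnit_append hl.1]
    split_ifs <;> simp
  · rw [insertUnit_append (hj.trans hl.1)]
    split_ifs <;> simp

theorem Valid.singleton {n x : ℕ} {st : Strand} (hx : x < n) : Valid n [st] [x] :=
  ⟨rfl, by simpa using hx⟩

/-- The trace over the color of the broken strand, of a long diagram with the operator `A` inserted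
between the words `w₁` and `w₂`. -/
def cutTrace (n : ℕ) (w₁ w₂ : List Slice)
    (A : (List ℕ → ℤ[T;T⁻¹]) → List ℕ → ℤ[T;T⁻¹]) : ℤ[T;T⁻¹] :=
  ∑ x ∈ Finset.range n, act n w₁ (A (act n w₂ (delta x))) [x]

theorem cutTrace_congr {n : ℕ} {w₁ w₂ : List Slice} {s : List Strand} (h₁ : IsTangle w₁ [up] s)
    {A B : (List ℕ → ℤ[T;T⁻¹]) → List ℕ → ℤ[T;T⁻¹]}
    (h : ∀ v i, Valid n s i → A v i = B v i) : cutTrace n w₁ w₂ A = cutTrace n w₁ w₂ B :=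
  Finset.sum_congr rfl fun _ hx =>
    act_congr h₁ (fun i hi => h _ i hi) _ (Valid.singleton (Finset.mem_range.mp hx))

theorem cutTrace_sum {n : ℕ} {w₁ w₂ : List Slice} {ι : Type*} (S : Finset ι) (c : ι → ℤ[T;T⁻¹])
    (A : ι → (List ℕ → ℤ[T;T⁻¹]) → List ℕ → ℤ[T;T⁻¹]) :
    cutTrace n w₁ w₂ (fun v i => ∑ k ∈ S, c k * A k v i) =
      ∑ k ∈ S, c k * cutTrace n w₁ w₂ (A k) := by
  simp only [cutTrace, act_sum _ S c, Finset.mul_sum]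
  exact Finset.sum_comm

/-- The trace vanishes on commutators with `E`. -/
theorem cutTrace_eAct_comm {n : ℕ} {w₁ w₂ : List Slice} {s : List Strand}
    (h₁ : IsTangle w₁ [up] s) (h₂ : IsTangle w₂ s [up])
    {A : (List ℕ → ℤ[T;T⁻¹]) → List ℕ → ℤ[T;T⁻¹]}
    (hA : ∀ c v i, A (fun j => c * v j) i = c * A v i)
    (hA' : ∀ v v' i, Valid n s i → (∀ j, Valid n s j → v j = v' j) → A v i = A v' i) :
    cutTrace n w₁ w₂ (fun v => eAct n s (A v)) = cutTrace n w₁ w₂ (fun v => A (eAct n s v)) := by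
  set g : ℕ → ℤ[T;T⁻¹] := fun x => eCoef n up x * act n w₁ (A (act n w₂ (delta x))) [x - 1]
  have hL : cutTrace n w₁ w₂ (fun v => eAct n s (A v)) = ∑ x ∈ Finset.range n, g x := by
    refine Finset.sum_congr rfl fun x hx => ?_
    rw [act_eAct h₁ _ _ (Valid.singleton (Finset.mem_range.mp hx))]
    simp [eAct, shift, g]
  have hR : cutTrace n w₁ w₂ (fun v => A (eAct n s v)) = ∑ x ∈ Finset.range n, g (x + 1) := by
    refine Finset.sum_congr rfl fun x hx => ?_
    rw [act_congr h₁ (u' := fun i => eCoef n up (x + 1) * A (act n w₂ (delta (x + 1))) i) _ _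
      (Valid.singleton (Finset.mem_range.mp hx)), act_mul_left]
    · rfl
    · intro i hi
      rw [← hA]
      refine hA' _ _ i hi fun j hj => ?_
      rw [← act_eAct h₂ _ j hj, ← act_mul_left]
      exact act_congr h₂ (fun i hi => eAct_delta x i hi) j hj
  -- Both traces are sums of the same function `g`, over `0, …, n - 1` and over `1, …, n`, and `g`
  -- vanishes at `0` and at `n`.
  have h3 := Finset.sum_range_succ' g n
  rw [Finset.sum_range_succ] at h3
  have g0 : g 0 = 0 := by simp [g, eCoef_up_zero]
  have gn : g n = 0 := by simp [g, eCoef_up_self]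
  rw [g0, gn, add_zero, add_zero] at h3
  rw [hL, hR, h3]

/-- The state sum in which the strand between `L` and `R`, at the level between `w₁` and `w₂`, has
the color `a`, with the rotation factors for cutting at this strand. -/
def cutSum (n : ℕ) (w₁ w₂ : List Slice) (L R : List Strand) (a : ℕ) : ℤ[T;T⁻¹] :=
  cutTrace n w₁ w₂ (insertUnit n L R (fun x y => T (2 * x - 2 * y)) a a)

theorem insertUnit_congr {n : ℕ} {L R : List Strand} {st : Strand} {f : ℤ → ℤ → ℤ[T;T⁻¹]}
    {a b : ℕ} (ha : a < n) {v v' : List ℕ → ℤ[T;T⁻¹]} {i : List ℕ}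
    (hi : Valid n (L ++ [st] ++ R) i) (h : ∀ j, Valid n (L ++ [st] ++ R) j → v j = v' j) :
    insertUnit n L R f b a v i = insertUnit n L R f b a v' i := by
  obtain ⟨l, c, r, rfl, hl, hc, hr⟩ := hi.exists_insert
  rw [insertUnit_append hl.1, insertUnit_append hl.1, h]
  exact (hl.append (Valid.singleton ha)).append hr

/-- The trace of the commutator in `eAct_insertUnit` is zero, and the coefficient of `E` can be
cancelled in a domain. -/
theorem cutSum_shift {n : ℕ} {w₁ w₂ : List Slice} {L R : List Strand} {st : Strand}
    (h₁ : IsTangle w₁ [up] (L ++ [st] ++ R)) (h₂ : IsTangle w₂ (L ++ [st] ++ R) [up]) {a : ℕ}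
    (han : a < n) (ha : eCoef n st a ≠ 0) :
    cutSum n w₁ w₂ L R a = cutSum n w₁ w₂ L R (shift st a) := by
  have h := cutTrace_eAct_comm h₁ h₂
    (A := insertUnit n L R (fun _ y => T (-(2 * y))) (shift st a) a)
    (fun c v i => by simp only [insertUnit]; split_ifs <;> ring)
    (fun v v' i hi h => insertUnit_congr han hi h)
  -- A difference of two operators is treated as a sum over `Bool` with coefficients of opposite
  -- sign.
  have h3 := cutTrace_sum (n := n) (w₁ := w₁) (w₂ := w₂) Finset.univ
    (fun b : Bool => if b then 1 else -1)
    (fun b => if b then fun v => eAct n (L ++ [st] ++ R)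
        (insertUnit n L R (fun _ y => T (-(2 * y))) (shift st a) a v)
      else fun v => insertUnit n L R (fun _ y => T (-(2 * y))) (shift st a) a
        (eAct n (L ++ [st] ++ R) v))
  have h4 := cutTrace_sum (n := n) (w₁ := w₁) (w₂ := w₂) Finset.univ
    (fun b : Bool => if b then eCoef n st a else -eCoef n st a)
    (fun b => if b then insertUnit n L R (fun x y => T (2 * x - 2 * y)) a a
      else insertUnit n L R (fun x y => T (2 * x - 2 * y)) (shift st a) (shift st a))
  simp only [Fintype.univ_bool, Finset.sum_insert, Finset.mem_singleton, Bool.true_eq_false,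
    not_false_eq_true, Finset.sum_singleton, if_true, Bool.false_eq_true, if_false, one_mul,
    neg_mul, ← sub_eq_add_neg, ← mul_sub (eCoef n st a)] at h3 h4
  rw [h, sub_self, cutTrace_congr h₁ fun v i hi => eAct_insertUnit ha v i hi, h4] at h3
  exact sub_eq_zero.mp ((mul_eq_zero.mp h3).resolve_left ha)

/-- All colors are linked by `E`, which lowers the color on an upward strand and raises it on a
downward one, with nonzero coefficients inside the range of colors. -/
theorem cutSum_eq_zero_color {n : ℕ} {w₁ w₂ : List Slice} {L R : List Strand} {st : Strand}
    (h₁ : IsTangle w₁ [up] (L ++ [st] ++ R)) (h₂ : IsTangle w₂ (L ++ [st] ++ R) [up]) {a : ℕ}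
    (ha : a < n) : cutSum n w₁ w₂ L R a = cutSum n w₁ w₂ L R 0 := by
  induction a with
  | zero => rfl
  | succ a ih =>
    rw [← ih (by omega)]
    cases st
    · refine cutSum_shift h₁ h₂ ha ?_
      rw [eCoef_up_of_pos (Nat.succ_pos a)]
      exact qint_ne_zero (by omega)
    · refine (cutSum_shift h₁ h₂ (Nat.lt_of_succ_lt ha) ?_).symm
      rw [eCoef, neg_ne_zero, mul_ne_zero_iff]
      exact ⟨(isUnit_T _).ne_zero, qint_ne_zero (by omega)⟩

/-- The quantum dimension of the color. -/
def qdim (n : ℕ) : ℤ[T;T⁻¹] := ∑ a ∈ Finset.range n, T (2 * ((n : ℤ) - 1 - 2 * a))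

theorem qint_one_mul_qdim (n : ℕ) : qint 1 * qdim n = qint n := by
  have h : ∀ a : ℕ, qint 1 * T (2 * ((n : ℤ) - 1 - 2 * a)) =
      T (2 * ((n : ℤ) - 2 * a)) - T (2 * ((n : ℤ) - 2 * (a + 1 : ℕ))) := by
    intro a
    rw [qint, sub_mul, ← T_add, ← T_add]
    push_cast
    ring_nf
  rw [qdim, Finset.mul_sum, Finset.sum_congr rfl fun a _ => h a,
    Finset.sum_range_sub' (fun a : ℕ => (T (2 * ((n : ℤ) - 2 * a)) : ℤ[T;T⁻¹])), qint]
  push_cast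
  ring_nf

theorem qdim_ne_zero {n : ℕ} (hn : 0 < n) : qdim n ≠ 0 := by
  intro h
  have h1 := qint_one_mul_qdim n
  rw [h, mul_zero] at h1
  exact qint_ne_zero (by omega : (n : ℤ) ≠ 0) h1.symm

theorem sum_T_neg_eq_qdim (n : ℕ) :
    ∑ a ∈ Finset.range n, (T (-(2 * ((n : ℤ) - 1 - 2 * a))) : ℤ[T;T⁻¹]) = qdim n := by
  rw [qdim, ← Finset.sum_range_reflect]
  refine Finset.sum_congr rfl fun a ha => ?_
  have := Finset.mem_range.mp ha
  congr 1
  omega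

theorem sum_T_wexp (n : ℕ) (st : Strand) :
    ∑ a ∈ Finset.range n, (T (2 * wexp n st a) : ℤ[T;T⁻¹]) = qdim n := by
  cases st
  · rfl
  · simp only [wexp, mul_neg]
    exact sum_T_neg_eq_qdim n

theorem sum_T_neg_wexp (n : ℕ) (st : Strand) :
    ∑ a ∈ Finset.range n, (T (-(2 * wexp n st a)) : ℤ[T;T⁻¹]) = qdim n := by
  cases st
  · exact sum_T_neg_eq_qdim n
  · simp only [wexp, mul_neg, neg_neg]
    rfl

/-- The trace with the rotation factors for cutting between the strands `L` and `R`. -/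
def gapTrace (n : ℕ) (w₁ w₂ : List Slice) (L R : List Strand) : ℤ[T;T⁻¹] :=
  cutTrace n w₁ w₂ fun v i =>
    T (2 * wexps n L (i.take L.length) - 2 * wexps n R (i.drop L.length)) * v i

/-! ### Moving the cut to another edge -/

theorem sum_insertUnit {n : ℕ} {L R : List Strand} {f : ℤ → ℤ → ℤ[T;T⁻¹]} {g : ℕ → ℤ[T;T⁻¹]}
    {v : List ℕ → ℤ[T;T⁻¹]} {l r : List ℕ} {c : ℕ} (hl : l.length = L.length) (hc : c < n) :
    ∑ a ∈ Finset.range n, g a * insertUnit n L R f a a v (l ++ [c] ++ r) =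
      g c * (f (wexps n L l) (wexps n R r) * v (l ++ [c] ++ r)) := by
  rw [Finset.sum_eq_single_of_mem c (Finset.mem_range.mpr hc)]
  · rw [insertUnit_append hl, if_pos rfl]
  · intro b _ hb
    rw [insertUnit_append hl, if_neg hb.symm, mul_zero, mul_zero]

/-- Weighting the colors of the cut strand by `K` moves this strand to the left side of the gap. As
the cut sum does not depend on the color, only the sum of the weights, the quantum dimension,
remains. -/
theorem gapTrace_right {n : ℕ} {w₁ w₂ : List Slice} {L R : List Strand} {st : Strand}
    (h₁ : IsTangle w₁ [up] (L ++ [st] ++ R)) (h₂ : IsTangle w₂ (L ++ [st] ++ R) [up]) :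
    gapTrace n w₁ w₂ (L ++ [st]) R = cutSum n w₁ w₂ L R 0 * qdim n := by
  rw [gapTrace, cutTrace_congr h₁ (B := fun v i => ∑ a ∈ Finset.range n,
    T (2 * wexp n st a) * insertUnit n L R (fun x y => T (2 * x - 2 * y)) a a v i)
    fun v i hi => ?_, cutTrace_sum]
  · rw [← sum_T_wexp n st, Finset.mul_sum]
    refine Finset.sum_congr rfl fun a ha => ?_
    rw [← cutSum_eq_zero_color h₁ h₂ (Finset.mem_range.mp ha), mul_comm]
    rfl
  · obtain ⟨l, c, r, rfl, hl, hc, hr⟩ := hi.exists_insert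
    rw [sum_insertUnit hl.1 hc, List.take_left' (by simp [hl.1]), List.drop_left' (by simp [hl.1]),
      wexps_append _ _ _ _ _ hl.1, ← mul_assoc, ← T_add]
    congr 2
    simp only [wexps]
    ring

/-- The inverse of `K` puts the strand to the right of the gap, and its trace is the same quantum
dimension, by the symmetry of the weights. -/
theorem gapTrace_left {n : ℕ} {w₁ w₂ : List Slice} {L R : List Strand} {st : Strand}
    (h₁ : IsTangle w₁ [up] (L ++ [st] ++ R)) (h₂ : IsTangle w₂ (L ++ [st] ++ R) [up]) :
    gapTrace n w₁ w₂ L (st :: R) = cutSum n w₁ w₂ L R 0 * qdim n := by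
  rw [gapTrace, cutTrace_congr h₁ (B := fun v i => ∑ a ∈ Finset.range n,
    T (-(2 * wexp n st a)) * insertUnit n L R (fun x y => T (2 * x - 2 * y)) a a v i)
    fun v i hi => ?_, cutTrace_sum]
  · rw [← sum_T_neg_wexp n st, Finset.mul_sum]
    refine Finset.sum_congr rfl fun a ha => ?_
    rw [← cutSum_eq_zero_color h₁ h₂ (Finset.mem_range.mp ha), mul_comm]
    rfl
  · obtain ⟨l, c, r, rfl, hl, hc, hr⟩ := hi.exists_insert
    rw [sum_insertUnit hl.1 hc, List.append_assoc, List.take_left' hl.1, List.drop_left' hl.1,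
      ← mul_assoc, ← T_add]
    congr 2
    simp only [wexps, List.singleton_append]
    ring

theorem gapTrace_eq {n : ℕ} {w₁ w₂ : List Slice} (L R : List Strand)
    (h₁ : IsTangle w₁ [up] (L ++ R)) (h₂ : IsTangle w₂ (L ++ R) [up]) :
    gapTrace n w₁ w₂ L R = gapTrace n w₁ w₂ (L ++ R) [] := by
  induction R generalizing L with
  | nil => rw [List.append_nil]
  | cons st R ih =>
    have e : L ++ st :: R = L ++ [st] ++ R := by simp
    rw [e] at h₁ h₂ ⊢
    rw [gapTrace_left h₁ h₂, ← gapTrace_right h₁ h₂, ih _ h₁ h₂]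

/-- At the rightmost gap the twist depends only on the total weight, which is conserved and can be
moved down to the bottom. -/
theorem gapTrace_nil {n : ℕ} {w₁ w₂ : List Slice} {s : List Strand}
    (h₁ : IsTangle w₁ [up] s) :
    gapTrace n w₁ w₂ s [] = gapTrace n [] (w₁ ++ w₂) [up] [] := by
  unfold gapTrace cutTrace
  refine Finset.sum_congr rfl fun x hx => ?_
  have hx := Valid.singleton (n := n) (st := up) (Finset.mem_range.mp hx)
  rw [act_append, act]
  have h := act_weight h₁ (fun e => T (2 * e)) (act n w₂ (delta x)) [x] hx
  have h3 := act_congr h₁ (u := fun i => T (2 * wexps n s (i.take s.length) -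
      2 * wexps n [] (i.drop s.length)) * act n w₂ (delta x) i)
    (u' := fun i => T (2 * wexps n s i) * act n w₂ (delta x) i) (fun i hi => by
      rw [← hi.1, List.take_length]
      simp [wexps]) [x] hx
  rw [h3, h]
  simp [wexps]

/-- The state sum of a long diagram does not depend on where the diagram is cut, nor on the color
of the cut strand. -/
theorem cutSum_eq_stateSum {n : ℕ} {w₁ w₂ : List Slice} {L R : List Strand} {st : Strand}
    (h₁ : IsTangle w₁ [up] (L ++ [st] ++ R)) (h₂ : IsTangle w₂ (L ++ [st] ++ R) [up])
    (h : IsTangle (w₁ ++ w₂) [up] [up]) {a : ℕ} (ha : a < n) :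
    cutSum n w₁ w₂ L R a = stateSum n (w₁ ++ w₂) [0] [0] := by
  have hn : 0 < n := (Nat.zero_le a).trans_lt ha
  rw [cutSum_eq_zero_color h₁ h₂ ha]
  have h3 : IsTangle [] [up] ([] ++ [up] ++ []) := IsTangle.nil [up]
  have h4 : cutSum n [] (w₁ ++ w₂) [] [] 0 = stateSum n (w₁ ++ w₂) [0] [0] := by
    rw [stateSum_eq_act hn, cutSum, cutTrace,
      -- Inserting the color `0` at the bottom strand leaves only the term `x = 0` of the trace.
      Finset.sum_eq_single_of_mem 0 (Finset.mem_range.mpr hn)]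
    · simp [act, insertUnit, wexps]
      rfl
    · intro x _ hx
      simp [act, insertUnit, hx]
  rw [← h4]
  -- After multiplication by the quantum dimension both sides are gap traces, and the gap can be
  -- moved along its level and then to the bottom.
  refine mul_right_cancel₀ (qdim_ne_zero hn) ?_
  rw [← gapTrace_right h₁ h₂, ← gapTrace_right h3 h, gapTrace_eq _ _ h₁ h₂, gapTrace_nil h₁]
  rfl

/-! ### Bounds for the local weights at a root of unity -/

/-- Evaluation at `q = exp (2 π i α / n)` as a ring homomorphism. -/
def evHom (α : ℝ) (n : ℕ) : ℤ[T;T⁻¹] →+* ℂ :=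
  LaurentPolynomial.eval₂ (Int.castRingHom ℂ)
    (Units.mk0 (Complex.exp (2 * Real.pi * Complex.I * α / (4 * n))) (Complex.exp_ne_zero _))

theorem norm_evHom_T (α : ℝ) (n : ℕ) (m : ℤ) : ‖evHom α n (T m)‖ = 1 := by
  have h : ‖Complex.exp (2 * Real.pi * Complex.I * α / (4 * n))‖ = 1 := by
    rw [show (2 * Real.pi * Complex.I * α / (4 * n) : ℂ) =
      ((2 * Real.pi * α / (4 * n) : ℝ) : ℂ) * Complex.I by push_cast; ring]
    exact Complex.norm_exp_ofReal_mul_I _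
  simp [evHom, norm_zpow, h]

theorem norm_evHom_qint_le (α : ℝ) (n : ℕ) (a : ℤ) : ‖evHom α n (qint a)‖ ≤ 2 := by
  rw [qint, map_sub]
  refine (norm_sub_le _ _).trans ?_
  rw [norm_evHom_T, norm_evHom_T]
  norm_num

theorem norm_evHom_qfalling_le (α : ℝ) (n : ℕ) (a : ℤ) (b : ℕ) :
    ‖evHom α n (qfalling a b)‖ ≤ 2 ^ b := by
  induction b with
  | zero => simp [qfalling]
  | succ b ih =>
    rw [qfalling_succ', map_mul, norm_mul, pow_succ]
    exact mul_le_mul ih (norm_evHom_qint_le α n _) (norm_nonneg _) (by positivity)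

/-- The Pascal recursion has coefficients of modulus one. The quotient of `q`-factorials would be of
no use here, since its denominator may evaluate to zero. -/
theorem norm_evHom_qbinom_le (α : ℝ) (n a b : ℕ) :
    ‖evHom α n (qbinom a b)‖ ≤ a.choose b := by
  induction a generalizing b with
  | zero => cases b <;> simp [qbinom]
  | succ a ih =>
    cases b with
    | zero => simp [qbinom]
    | succ b =>
      rw [qbinom, map_add, Nat.choose_succ_succ, add_comm (a.choose b)]
      refine (norm_add_le _ _).trans ?_
      rw [map_mul, map_mul, norm_mul, norm_mul, norm_evHom_T, norm_evHom_T, one_mul, one_mul]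
      push_cast
      exact add_le_add (ih _) (ih _)

/-- A bound for the weight of a piece with variable `k`. -/
def cost (n : ℕ) (p : Piece) (k : ℕ) : ℝ := if p.sign ≠ 0 ∧ k ≠ 0 then 4 ^ n else 1

theorem one_le_cost (n : ℕ) (p : Piece) (k : ℕ) : 1 ≤ cost n p k := by
  rw [cost]
  split_ifs
  · exact one_le_pow₀ (by norm_num)
  · rfl

theorem cost_le (n : ℕ) (p : Piece) (k : ℕ) : cost n p k ≤ 4 ^ n := by
  rw [cost]
  split_ifs
  · rfl
  · exact one_le_pow₀ (by norm_num)

/-- The binomial is at most `2 ^ (b + k)` and the falling product at most `2 ^ k`, and both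
exponents are below `n`. For `k = 0` both factors are `1`, which is the source of the saving. -/
theorem norm_evHom_crossing_le (α : ℝ) (n b k : ℕ) (e m : ℤ) (hk : k < n) (hb : b + k < n) :
    ‖evHom α n (T e * qbinom (b + k) k * qfalling m k)‖ ≤ if k ≠ 0 then 4 ^ n else 1 := by
  rw [map_mul, map_mul, norm_mul, norm_mul, norm_evHom_T, one_mul]
  split_ifs with h
  · calc _ ≤ ((b + k).choose k : ℝ) * 2 ^ k :=
          mul_le_mul (norm_evHom_qbinom_le α n _ _) (norm_evHom_qfalling_le α n _ _)
            (norm_nonneg _) (by positivity)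
      _ ≤ 2 ^ (b + k) * 2 ^ k := by
          gcongr
          exact_mod_cast Nat.choose_le_two_pow (b + k) k
      _ ≤ 2 ^ n * 2 ^ n := by
          gcongr
          · norm_num
          · norm_num
      _ = 4 ^ n := by rw [← mul_pow]; norm_num
  · obtain rfl : k = 0 := by omega
    have : qbinom b 0 = 1 := by cases b <;> rfl
    simp [this, qfalling]

theorem norm_evHom_pieceWt_le (α : ℝ) {n : ℕ} {p : Piece} {k : ℕ} {m : List ℕ} (hk : k < n)
    (hm : m.length = p.bot.length) : ‖evHom α n (pieceWt n p k m)‖ ≤ cost n p k := by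
  cases p
  case cupUD =>
    obtain rfl := List.length_eq_zero_iff.mp hm
    simp [pieceWt, cost, Piece.sign]
  case cupDU =>
    obtain rfl := List.length_eq_zero_iff.mp hm
    simp [pieceWt, cost, Piece.sign, norm_evHom_T]
  all_goals obtain ⟨a, b, rfl⟩ := List.length_eq_two.mp hm
  case posCrossing =>
    rw [pieceWt, posWt]
    split_ifs with h
    · have h1 := norm_evHom_crossing_le α n b k
        (-(((n : ℤ) - 1 - 2 * a) * (n - 1 - 2 * b) + k * (k - 1))) (n - 1 + k - a) hk h.2
      have h2 : ‖evHom α n ((-1) ^ k)‖ = 1 := by simp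
      rw [Rpos, mul_assoc, mul_assoc, map_mul, norm_mul, h2, one_mul, ← mul_assoc]
      simpa [cost, Piece.sign] using h1
    · rw [map_zero, norm_zero]
      exact zero_le_one.trans (one_le_cost _ _ _)
  case negCrossing =>
    rw [pieceWt, negWt]
    split_ifs with h
    · rw [Rneg]
      simpa [cost, Piece.sign] using norm_evHom_crossing_le α n a k
        (((n : ℤ) - 1 - 2 * a - 2 * k) * (n - 1 - 2 * b + 2 * k) + k * (k - 1)) (n - 1 + k - b)
        hk h.2
    · rw [map_zero, norm_zero]
      exact zero_le_one.trans (one_le_cost _ _ _)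
  case capUD =>
    rw [pieceWt]
    split_ifs <;> simp [cost, Piece.sign, norm_evHom_T]
  case capDU =>
    rw [pieceWt]
    split_ifs <;> simp [cost, Piece.sign]

/-! ### States -/

/-- A state of nonzero weight: `σ h` are the colors at the level above the first `h` slices, and
`κ h` is the variable of the piece of the next slice. -/
def IsState (n : ℕ) (w : List Slice) (σ : ℕ → List ℕ) (κ : ℕ → ℕ) : Prop :=
  ∀ h s, w[h]? = some s → κ h < n ∧ pieceWt n s.piece (κ h) (s.mid (σ h)) ≠ 0 ∧
    σ (h + 1) = sliceOut s (κ h) (σ h)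

/-- A bound for the weight of a state. -/
def stateCost (n : ℕ) : List Slice → (ℕ → ℕ) → ℝ
  | [], _ => 1
  | s :: w, κ => cost n s.piece (κ 0) * stateCost n w (fun h => κ (h + 1))

theorem one_le_stateCost (n : ℕ) (w : List Slice) (κ : ℕ → ℕ) : 1 ≤ stateCost n w κ := by
  induction w generalizing κ with
  | nil => exact le_rfl
  | cons s w ih => exact one_le_mul_of_one_le_of_one_le (one_le_cost _ _ _) (ih _)

theorem stateCost_append (n : ℕ) (w₁ w₂ : List Slice) (κ : ℕ → ℕ) :
    stateCost n (w₁ ++ w₂) κ =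
      stateCost n w₁ κ * stateCost n w₂ (fun h => κ (h + w₁.length)) := by
  induction w₁ generalizing κ with
  | nil => simp [stateCost]
  | cons s w ih =>
    rw [List.cons_append, stateCost, stateCost, ih, mul_assoc]
    rfl

theorem stateCost_congr (n : ℕ) (w : List Slice) {κ κ' : ℕ → ℕ}
    (h : ∀ i < w.length, κ i = κ' i) : stateCost n w κ = stateCost n w κ' := by
  induction w generalizing κ κ' with
  | nil => rfl
  | cons s w ih =>
    rw [stateCost, stateCost, h 0 (by simp), ih fun i hi => h (i + 1) (by simpa using hi)]

theorem IsState.cons {n : ℕ} {s : Slice} {w : List Slice} {σ : ℕ → List ℕ} {κ : ℕ → ℕ}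
    (h : IsState n w σ κ) {i : List ℕ} {k : ℕ} (hk : k < n)
    (hw : pieceWt n s.piece k (s.mid i) ≠ 0) (hσ : σ 0 = sliceOut s k i) :
    IsState n (s :: w) (fun h => Nat.casesOn h i σ) (fun h => Nat.casesOn h k κ) := by
  rintro (_ | h') s' hs
  · obtain rfl : s = s' := by simpa using hs
    exact ⟨hk, hw, hσ⟩
  · exact h h' s' (by simpa using hs)

/-- Each slice has at most `n` values of its variable, which gives the power of `n`. In the
induction the cost of the first slice is divided out of `B`, so that the hypothesis always concerns
a whole state. -/
theorem norm_evHom_act_le (α : ℝ) {n : ℕ} {w : List Slice} {s t : List Strand}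
    (hw : IsTangle w s t) (u : List ℕ → ℤ[T;T⁻¹]) {i : List ℕ} (hi : Valid n s i) {B : ℝ}
    (hB0 : 0 ≤ B)
    (hB : ∀ σ κ, IsState n w σ κ → σ 0 = i →
      stateCost n w κ * ‖evHom α n (u (σ w.length))‖ ≤ B) :
    ‖evHom α n (act n w u i)‖ ≤ n ^ w.length * B := by
  induction hw generalizing i B with
  | nil s =>
    simpa [stateCost, act] using hB (fun _ => i) (fun _ => 0) (by simp [IsState]) rfl
  | cons L R t p w _ ih =>
    rw [act, sliceAct, map_sum]
    have key : ∀ k ∈ Finset.range n, ‖evHom α n (pieceWt n p k (Slice.mid ⟨L.length, p⟩ i) *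
        act n w u (sliceOut ⟨L.length, p⟩ k i))‖ ≤ n ^ w.length * B := by
      intro k hk
      have hk := Finset.mem_range.mp hk
      by_cases h0 : pieceWt n p k (Slice.mid ⟨L.length, p⟩ i) = 0
      · rw [h0, zero_mul, map_zero, norm_zero]
        positivity
      · have hc : 0 < cost n p k := zero_lt_one.trans_le (one_le_cost n p k)
        have h1 := ih (sliceOut_valid hk hi h0).1 (B := B / cost n p k) (by positivity)
          fun σ κ hσ h2 => by
            have h3 := hB _ _ (hσ.cons hk (i := i) (s := ⟨L.length, p⟩) h0 h2) rfl
            rw [le_div_iff₀ hc]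
            calc _ = cost n p k * stateCost n w κ * ‖evHom α n (u (σ w.length))‖ := by ring
              _ ≤ B := h3
        have hm : (Slice.mid ⟨L.length, p⟩ i).length = p.bot.length := by
          have := hi.1
          simp only [List.length_append] at this
          simp only [Slice.mid, List.length_take, List.length_drop]
          omega
        rw [map_mul, norm_mul]
        calc _ ≤ cost n p k * (n ^ w.length * (B / cost n p k)) :=
              mul_le_mul (norm_evHom_pieceWt_le α hk hm) h1 (norm_nonneg _) hc.le
          _ = n ^ w.length * B := by field_simp
    refine (norm_sum_le _ _).trans ((Finset.sum_le_sum key).trans (le_of_eq ?_))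
    rw [Finset.sum_const, Finset.card_range, nsmul_eq_mul, List.length_cons, pow_succ]
    ring

theorem IsState.append {n : ℕ} {w₁ w₂ : List Slice} {σ₁ σ₂ : ℕ → List ℕ} {κ₁ κ₂ : ℕ → ℕ}
    (h₁ : IsState n w₁ σ₁ κ₁) (h₂ : IsState n w₂ σ₂ κ₂) (h : σ₂ 0 = σ₁ w₁.length) :
    IsState n (w₁ ++ w₂)
      (fun i => if i ≤ w₁.length then σ₁ i else σ₂ (i - w₁.length))
      (fun i => if i < w₁.length then κ₁ i else κ₂ (i - w₁.length)) := by
  intro i s hs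
  rcases lt_or_ge i w₁.length with hi | hi
  · rw [List.getElem?_append_left hi] at hs
    simpa [hi, hi.le, Nat.succ_le_of_lt hi] using h₁ i s hs
  · rw [List.getElem?_append_right hi] at hs
    have h3 := h₂ _ s hs
    rcases hi.eq_or_lt with rfl | hi
    · simpa [h] using h3
    · simpa [hi.not_ge, hi.not_gt, show ¬ i + 1 ≤ w₁.length by omega,
        show i + 1 - w₁.length = i - w₁.length + 1 by omega] using h3

theorem IsState.valid {n : ℕ} {w : List Slice} {s t : List Strand} (hw : IsTangle w s t)
    {σ : ℕ → List ℕ} {κ : ℕ → ℕ} (h : IsState n w σ κ) (h0 : Valid n s (σ 0)) :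
    Valid n t (σ w.length) := by
  induction hw generalizing σ κ with
  | nil s => exact h0
  | cons L R t p w _ ih =>
    have h1 := h 0 _ rfl
    refine ih (σ := fun h => σ (h + 1)) (κ := fun h => κ (h + 1))
      (fun h' s hs => h (h' + 1) s (by simpa using hs)) ?_
    rw [h1.2.2]
    exact (sliceOut_valid h1.1 h0 h1.2.1).1

/-- A bound for the state sum in which the strand between `L` and `R` has the color `a`. -/
theorem norm_evHom_cutSum_le (α : ℝ) {n : ℕ} {w₁ w₂ : List Slice} {L R : List Strand}
    {st : Strand} (h₁ : IsTangle w₁ [up] (L ++ [st] ++ R))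
    (h₂ : IsTangle w₂ (L ++ [st] ++ R) [up]) {a : ℕ} {B : ℝ} (hB0 : 0 ≤ B)
    (hB : ∀ σ κ, IsState n (w₁ ++ w₂) σ κ → Valid n [up] (σ 0) →
      (σ w₁.length)[L.length]? = some a → stateCost n (w₁ ++ w₂) κ ≤ B) :
    ‖evHom α n (cutSum n w₁ w₂ L R a)‖ ≤ n ^ ((w₁ ++ w₂).length + 1) * B := by
  rw [cutSum, cutTrace, map_sum]
  have key : ∀ x ∈ Finset.range n, ‖evHom α n (act n w₁ (insertUnit n L R
      (fun x y => T (2 * x - 2 * y)) a a (act n w₂ (delta x))) [x])‖ ≤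
        n ^ w₁.length * (n ^ w₂.length * B) := by
    intro x hx
    have hx : Valid n [up] [x] := Valid.singleton (Finset.mem_range.mp hx)
    refine norm_evHom_act_le α h₁ _ hx (by positivity) fun σ κ hσ h0 => ?_
    have hv : Valid n (L ++ [st] ++ R) (σ w₁.length) := hσ.valid h₁ (by rwa [h0])
    have hc : 0 < stateCost n w₁ κ := zero_lt_one.trans_le (one_le_stateCost _ _ _)
    obtain ⟨l, c, r, hlcr, hl, hcn, hr⟩ := hv.exists_insert
    rw [hlcr, insertUnit_append hl.1]
    by_cases hca : c = a
    · subst hca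
      rw [if_pos rfl, map_mul, norm_mul, norm_evHom_T, one_mul, ← hlcr]
      have h3 := norm_evHom_act_le α h₂ (delta x) hv (B := B / stateCost n w₁ κ) (by positivity)
        fun σ' κ' hσ' h0' => by
          -- A state below the cut and a state above it that agree there form a state of the whole
          -- word, to which the hypothesis applies.
          have h4 := hB _ _ (hσ.append hσ' h0') (by simpa [h0] using hx)
            (by simp [hlcr, ← hl.1])
          rw [stateCost_append, stateCost_congr n w₁ (κ' := κ) (fun i hi => if_pos hi),
            stateCost_congr n w₂ (κ' := κ') (fun i hi => by simp)] at h4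
          have h5 : ‖evHom α n (delta x (σ' w₂.length))‖ ≤ 1 := by
            rw [delta]
            split_ifs <;> simp
          rw [le_div_iff₀ hc]
          have h6 : 0 ≤ stateCost n w₂ κ' := zero_le_one.trans (one_le_stateCost _ _ _)
          calc _ ≤ stateCost n w₂ κ' * 1 * stateCost n w₁ κ := by gcongr
            _ = stateCost n w₁ κ * stateCost n w₂ κ' := by ring
            _ ≤ B := h4
      calc _ ≤ stateCost n w₁ κ * (n ^ w₂.length * (B / stateCost n w₁ κ)) := by gcongr
        _ = n ^ w₂.length * B := by field_simp
    · rw [if_neg hca, mul_zero, map_zero, norm_zero, mul_zero]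
      positivity
  -- The additional factor `n` counts the colors of the broken strand.
  refine (norm_sum_le _ _).trans ((Finset.sum_le_sum key).trans (le_of_eq ?_))
  rw [Finset.sum_const, Finset.card_range, nsmul_eq_mul, List.length_append, pow_succ, pow_add]
  ring

/-- The number of crossings of a word. -/
def wordCrossings (w : List Slice) : ℕ := (w.filter (fun s => s.piece.sign ≠ 0)).length

/-! ### The saving from crossings with angle zero -/

theorem stateCost_le (n : ℕ) (w : List Slice) (κ : ℕ → ℕ) :
    stateCost n w κ ≤ (4 ^ n) ^ wordCrossings w := by
  induction w generalizing κ with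
  | nil => simp [stateCost, wordCrossings]
  | cons s w ih =>
    have h1 := zero_le_one.trans (one_le_stateCost n w fun h => κ (h + 1))
    by_cases hs : s.piece.sign = 0
    · have h : wordCrossings (s :: w) = wordCrossings w := by simp [wordCrossings, hs]
      rw [h, stateCost, cost, if_neg (by simp [hs]), one_mul]
      exact ih _
    · have h : wordCrossings (s :: w) = wordCrossings w + 1 := by simp [wordCrossings, hs]
      rw [h, stateCost, pow_succ, mul_comm]
      exact mul_le_mul (ih _) (cost_le _ _ _) (zero_le_one.trans (one_le_cost _ _ _))
        (by positivity)

/-- A crossing with angle zero costs `1` instead of `4 ^ n`. The factor stands on the left to avoid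
subtraction in the exponent. -/
theorem stateCost_mul_le (n : ℕ) (w : List Slice) (κ : ℕ → ℕ) {P : ℕ} {s : Slice}
    (hP : w[P]? = some s) (hs : s.piece.sign ≠ 0) (hκ : κ P = 0) :
    stateCost n w κ * 4 ^ n ≤ (4 ^ n) ^ wordCrossings w := by
  induction w generalizing κ P with
  | nil => simp at hP
  | cons s' w ih =>
    have h1 := zero_le_one.trans (one_le_stateCost n w fun h => κ (h + 1))
    rcases P with _ | P
    · obtain rfl : s' = s := by simpa using hP
      have h : wordCrossings (s' :: w) = wordCrossings w + 1 := by simp [wordCrossings, hs]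
      rw [h, stateCost, cost, if_neg (by simp [hκ]), one_mul, pow_succ]
      exact mul_le_mul_of_nonneg_right (stateCost_le _ _ _) (by positivity)
    · have ih := ih (fun h => κ (h + 1)) (by simpa using hP) hκ
      by_cases hs : s'.piece.sign = 0
      · have h : wordCrossings (s' :: w) = wordCrossings w := by simp [wordCrossings, hs]
        rw [h, stateCost, cost, if_neg (by simp [hs]), one_mul]
        exact ih
      · have h : wordCrossings (s' :: w) = wordCrossings w + 1 := by simp [wordCrossings, hs]
        rw [h, stateCost, pow_succ, mul_assoc, mul_comm]
        exact mul_le_mul ih (cost_le _ _ _) (zero_le_one.trans (one_le_cost _ _ _))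
          (by positivity)

theorem stateCost_mul_mul_le (n : ℕ) (w : List Slice) (κ : ℕ → ℕ) {P Q : ℕ} {s s' : Slice}
    (hPQ : P < Q) (hP : w[P]? = some s) (hs : s.piece.sign ≠ 0) (hκ : κ P = 0)
    (hQ : w[Q]? = some s') (hs' : s'.piece.sign ≠ 0) (hκ' : κ Q = 0) :
    stateCost n w κ * 4 ^ n * 4 ^ n ≤ (4 ^ n) ^ wordCrossings w := by
  induction w generalizing κ P Q with
  | nil => simp at hP
  | cons s₀ w ih =>
    have h1 := zero_le_one.trans (one_le_stateCost n w fun h => κ (h + 1))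
    obtain ⟨Q, rfl⟩ : ∃ Q', Q = Q' + 1 := ⟨Q - 1, by omega⟩
    rcases P with _ | P
    · obtain rfl : s₀ = s := by simpa using hP
      have h : wordCrossings (s₀ :: w) = wordCrossings w + 1 := by simp [wordCrossings, hs]
      rw [h, stateCost, cost, if_neg (by simp [hκ]), one_mul, pow_succ]
      exact mul_le_mul_of_nonneg_right
        (stateCost_mul_le _ _ _ (P := Q) (by simpa using hQ) hs' hκ') (by positivity)
    · have ih := ih (fun h => κ (h + 1)) (P := P) (Q := Q) (by omega) (by simpa using hP) hκ
        (by simpa using hQ) hκ'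
      by_cases hs : s₀.piece.sign = 0
      · have h : wordCrossings (s₀ :: w) = wordCrossings w := by simp [wordCrossings, hs]
        rw [h, stateCost, cost, if_neg (by simp [hs]), one_mul]
        exact ih
      · have h : wordCrossings (s₀ :: w) = wordCrossings w + 1 := by simp [wordCrossings, hs]
        rw [h, stateCost, pow_succ, mul_assoc, mul_assoc, mul_comm, ← mul_assoc]
        exact mul_le_mul ih (cost_le _ _ _) (zero_le_one.trans (one_le_cost _ _ _))
          (by positivity)

/-! ### The edges of a diagram -/

/-- `lev h` is the sequence of strands at the level above the first `h` slices of `w`. -/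
def Levels (w : List Slice) (lev : ℕ → List Strand) : Prop :=
  ∀ h s, w[h]? = some s → ∃ L R, s.left = L.length ∧ lev h = L ++ s.piece.bot ++ R ∧
    lev (h + 1) = L ++ s.piece.top ++ R

theorem IsTangle.exists_levels {w : List Slice} {s t : List Strand} (hw : IsTangle w s t) :
    ∃ lev, lev 0 = s ∧ lev w.length = t ∧ Levels w lev := by
  induction hw with
  | nil s => exact ⟨fun _ => s, rfl, rfl, fun h s hs => by simp at hs⟩
  | cons L R t p w _ ih =>
    obtain ⟨lev, h0, ht, h⟩ := ih
    refine ⟨fun h => Nat.casesOn h (L ++ p.bot ++ R) lev, rfl, ht, ?_⟩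
    rintro (_ | h') s hs
    · obtain rfl : _ = s := by simpa using hs
      exact ⟨L, R, rfl, rfl, h0⟩
    · exact h h' s (by simpa using hs)

theorem Levels.isTangle {w : List Slice} {lev : ℕ → List Strand} (h : Levels w lev) :
    IsTangle w (lev 0) (lev w.length) := by
  induction w generalizing lev with
  | nil => exact IsTangle.nil _
  | cons s w ih =>
    obtain ⟨left, p⟩ := s
    obtain ⟨L, R, h1, h2, h3⟩ := h 0 _ rfl
    have h4 := ih (lev := fun h => lev (h + 1)) fun h' s hs => h (h' + 1) s (by simpa using hs)
    simp only at h1 h2 h3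
    subst h1
    rw [zero_add] at h3
    rw [h2]
    refine IsTangle.cons L R _ p w ?_
    rw [← h3]
    exact h4

theorem Levels.take {w : List Slice} {lev : ℕ → List Strand} (h : Levels w lev) (k : ℕ) :
    Levels (w.take k) lev := fun h' s hs => h h' s (by
  rw [List.getElem?_take] at hs
  split_ifs at hs
  exact hs)

theorem Levels.drop {w : List Slice} {lev : ℕ → List Strand} (h : Levels w lev) (k : ℕ) :
    Levels (w.drop k) (fun i => lev (k + i)) := fun h' s hs => h (k + h') s (by simpa using hs)

theorem IsTangle.width_eq {w : List Slice} {s t : List Strand} (hw : IsTangle w s t) :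
    width s.length w = t.length := by
  induction hw with
  | nil s => rfl
  | cons L R t p w _ ih =>
    rw [← ih, width, width, List.foldl_cons]
    congr 1
    simp only [List.length_append]
    omega

theorem Levels.width_take {w : List Slice} {lev : ℕ → List Strand} (h : Levels w lev)
    (h0 : lev 0 = [up]) {k : ℕ} (hk : k ≤ w.length) : width 1 (w.take k) = (lev k).length := by
  have h1 := (h.take k).isTangle.width_eq
  rwa [h0, List.length_take, min_eq_left hk] at h1

theorem getElem?_append_left₃ {α : Type*} (l m r : List α) {i : ℕ} (hi : i < l.length) :
    (l ++ m ++ r)[i]? = l[i]? := by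
  rw [List.append_assoc, List.getElem?_append_left hi]

theorem getElem?_append_right₃ {α : Type*} (l m r : List α) (i : ℕ) :
    (l ++ m ++ r)[l.length + m.length + i]? = r[i]? := by
  rw [List.getElem?_append_right (by simp)]
  simp

theorem getElem?_append_mid₃ {α : Type*} (l m r : List α) {i : ℕ} (hi : i < m.length) :
    (l ++ m ++ r)[l.length + i]? = m[i]? := by
  rw [List.append_assoc, List.getElem?_append_right (by simp), Nat.add_sub_cancel_left,
    List.getElem?_append_left hi]

/-- The pieces of curve without crossings in a slice. A point of its boundary is a pair of a truth
value, `true` at the top, and a position. -/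
inductive Link (s : Slice) : Bool × ℕ → Bool × ℕ → Prop
  | leftUp (i : ℕ) (hi : i < s.left) : Link s (false, i) (true, i)
  | leftDown (i : ℕ) (hi : i < s.left) : Link s (true, i) (false, i)
  | rightUp (i : ℕ) :
      Link s (false, s.left + s.piece.bot.length + i) (true, s.left + s.piece.top.length + i)
  | rightDown (i : ℕ) :
      Link s (true, s.left + s.piece.top.length + i) (false, s.left + s.piece.bot.length + i)
  | cupRight (hp : s.piece.bot = []) : Link s (true, s.left) (true, s.left + 1)
  | cupLeft (hp : s.piece.bot = []) : Link s (true, s.left + 1) (true, s.left)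
  | capRight (hp : s.piece.top = []) : Link s (false, s.left) (false, s.left + 1)
  | capLeft (hp : s.piece.top = []) : Link s (false, s.left + 1) (false, s.left)

theorem Link.symm {s : Slice} {x y : Bool × ℕ} (h : Link s x y) : Link s y x := by
  cases h
  · exact .leftDown _ ‹_›
  · exact .leftUp _ ‹_›
  · exact .rightDown _
  · exact .rightUp _
  · exact .cupLeft ‹_›
  · exact .cupRight ‹_›
  · exact .capLeft ‹_›
  · exact .capRight ‹_›

theorem Piece.length_top_of_bot {p : Piece} (h : p.bot = []) : p.top.length = 2 := by
  cases p <;> simp_all [Piece.bot, Piece.top]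

theorem Piece.length_bot_of_top {p : Piece} (h : p.top = []) : p.bot.length = 2 := by
  cases p <;> simp_all [Piece.bot, Piece.top]

theorem Piece.bot_of_sign {p : Piece} (h : p.sign ≠ 0) : p.bot = [up, up] := by
  cases p <;> simp_all [Piece.bot, Piece.sign]

theorem Piece.top_of_sign {p : Piece} (h : p.sign ≠ 0) : p.top = [up, up] := by
  cases p <;> simp_all [Piece.top, Piece.sign]

/-- A link in terms of the number of strands of the piece. -/
theorem Link.dest {s : Slice} {x y : Bool × ℕ} (h : Link s x y) :
    (x.2 < s.left ∧ y = (!x.1, x.2)) ∨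
    (x.1 = false ∧ s.left + s.piece.bot.length ≤ x.2 ∧
      y = (true, x.2 - s.piece.bot.length + s.piece.top.length)) ∨
    (x.1 = true ∧ s.left + s.piece.top.length ≤ x.2 ∧
      y = (false, x.2 - s.piece.top.length + s.piece.bot.length)) ∨
    (s.left ≤ x.2 ∧ x.2 < s.left + 2 ∧ y = (x.1, 2 * s.left + 1 - x.2) ∧
      (x.1 = true ∧ s.piece.bot.length = 0 ∧ s.piece.top.length = 2 ∨
        x.1 = false ∧ s.piece.bot.length = 2 ∧ s.piece.top.length = 0)) := by
  cases h
  case leftUp => simp_all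
  case leftDown => simp_all
  case rightUp i =>
    refine Or.inr (Or.inl ⟨rfl, by simp, ?_⟩)
    simp only [Prod.mk.injEq, true_and]
    omega
  case rightDown i =>
    refine Or.inr (Or.inr (Or.inl ⟨rfl, by simp, ?_⟩))
    simp only [Prod.mk.injEq, true_and]
    omega
  case cupRight hp =>
    have := Piece.length_top_of_bot hp
    simp [this, hp]; omega
  case cupLeft hp =>
    have := Piece.length_top_of_bot hp
    simp [this, hp]; omega
  case capRight hp =>
    have := Piece.length_bot_of_top hp
    simp [this, hp]; omega
  case capLeft hp =>
    have := Piece.length_bot_of_top hp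
    simp [this, hp]; omega

/-- The cases of `Link.dest` either prescribe the same end or exclude each other by the position of
`x` and the shape of the piece. -/
theorem Link.right_unique {s : Slice} {x y z : Bool × ℕ} (hy : Link s x y) (hz : Link s x z) :
    y = z := by
  obtain ⟨b, i⟩ := x
  have h1 := hy.dest
  have h2 := hz.dest
  simp only at h1 h2
  rcases h1 with ⟨a₁, rfl⟩ | ⟨a₁, b₁, rfl⟩ | ⟨a₁, b₁, rfl⟩ |
      ⟨a₁, b₁, rfl, ⟨c₁, d₁, e₁⟩ | ⟨c₁, d₁, e₁⟩⟩ <;>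
    rcases h2 with ⟨a₂, rfl⟩ | ⟨a₂, b₂, rfl⟩ | ⟨a₂, b₂, rfl⟩ |
      ⟨a₂, b₂, rfl, ⟨c₂, d₂, e₂⟩ | ⟨c₂, d₂, e₂⟩⟩ <;>
    first
    | rfl
    | (exfalso; omega)
    | (exfalso; simp_all)

/-- The point of a diagram given by a point of the boundary of the slice `h`. -/
def pt (h : ℕ) (x : Bool × ℕ) : ℕ × ℕ := (h + x.1.toNat, x.2)

/-- `Arc w lev p q`: in the direction of the strands, the curve runs from `p` to `q` through one
slice, and not through a crossing. -/
def Arc (w : List Slice) (lev : ℕ → List Strand) (p q : ℕ × ℕ) : Prop :=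
  ∃ h s x y, w[h]? = some s ∧ Link s x y ∧ p = pt h x ∧ q = pt h y ∧
    (lev p.1)[p.2]? = some (if x.1 then down else up) ∧
    (lev q.1)[q.2]? = some (if y.1 then up else down)

/-- The direction of the strand at `p` decides whether the curve continues into the slice above or
below, and inside a slice the link is unique. -/
theorem Arc.right_unique {w : List Slice} {lev : ℕ → List Strand} {p q q' : ℕ × ℕ}
    (hq : Arc w lev p q) (hq' : Arc w lev p q') : q = q' := by
  obtain ⟨h, s, ⟨b, i⟩, y, hs, hl, rfl, rfl, hd, -⟩ := hq
  obtain ⟨h', s', ⟨b', i'⟩, y', hs', hl', hp, rfl, hd', -⟩ := hq'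
  rw [hd] at hd'
  obtain rfl : b = b' := by cases b <;> cases b' <;> simp_all
  simp only [pt, Prod.mk.injEq, add_left_inj] at hp
  obtain ⟨rfl, rfl⟩ := hp
  obtain rfl : s = s' := by simpa [hs] using hs'
  rw [hl.right_unique hl']

theorem Arc.left_unique {w : List Slice} {lev : ℕ → List Strand} {p p' q : ℕ × ℕ}
    (hp : Arc w lev p q) (hp' : Arc w lev p' q) : p = p' := by
  obtain ⟨h, s, x, ⟨b, i⟩, hs, hl, rfl, rfl, -, hd⟩ := hp
  obtain ⟨h', s', x', ⟨b', i'⟩, hs', hl', rfl, hq, -, hd'⟩ := hp'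
  rw [hd] at hd'
  obtain rfl : b = b' := by cases b <;> cases b' <;> simp_all
  simp only [pt, Prod.mk.injEq, add_left_inj] at hq
  obtain ⟨rfl, rfl⟩ := hq
  obtain rfl : s = s' := by simpa [hs] using hs'
  rw [hl.symm.right_unique hl'.symm]

/-- `p` is one of the two points below the crossing in the slice `h`. -/
def InCorner (w : List Slice) (h : ℕ) (p : ℕ × ℕ) : Prop :=
  ∃ s, w[h]? = some s ∧ s.piece.sign ≠ 0 ∧ (p = (h, s.left) ∨ p = (h, s.left + 1))

/-- `p` is one of the two points above the crossing in the slice `h`. -/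
def OutCorner (w : List Slice) (h : ℕ) (p : ℕ × ℕ) : Prop :=
  ∃ s, w[h]? = some s ∧ s.piece.sign ≠ 0 ∧ (p = (h + 1, s.left) ∨ p = (h + 1, s.left + 1))

theorem Link.not_corner {s : Slice} (hs : s.piece.sign ≠ 0) {x y : Bool × ℕ} (h : Link s x y)
    (hx : x.2 = s.left ∨ x.2 = s.left + 1) : False := by
  have h1 := h.dest
  rw [Piece.bot_of_sign hs, Piece.top_of_sign hs] at h1
  simp only [List.length_cons, List.length_nil] at h1
  omega

theorem InCorner.lev {w : List Slice} {lev : ℕ → List Strand} (hw : Levels w lev) {h : ℕ}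
    {p : ℕ × ℕ} (hp : InCorner w h p) : p.1 = h ∧ (lev p.1)[p.2]? = some up := by
  obtain ⟨s, hs, hn, hp⟩ := hp
  obtain ⟨L, R, h1, h2, -⟩ := hw h s hs
  rcases hp with rfl | rfl <;> simp [h1, h2, Piece.bot_of_sign hn]

theorem OutCorner.lev {w : List Slice} {lev : ℕ → List Strand} (hw : Levels w lev) {h : ℕ}
    {p : ℕ × ℕ} (hp : OutCorner w h p) : p.1 = h + 1 ∧ (lev p.1)[p.2]? = some up := by
  obtain ⟨s, hs, hn, hp⟩ := hp
  obtain ⟨L, R, h1, -, h2⟩ := hw h s hs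
  rcases hp with rfl | rfl <;> simp [h1, h2, Piece.top_of_sign hn]

/-- The strand points up into the crossing, and a corner of a crossing belongs to no link; so an
edge ends here. -/
theorem InCorner.not_arc {w : List Slice} {lev : ℕ → List Strand} (hw : Levels w lev) {h : ℕ}
    {p q : ℕ × ℕ} (hp : InCorner w h p) : ¬ Arc w lev p q := by
  rintro ⟨h', s', ⟨b, i⟩, y, hs', hl, rfl, -, hd, -⟩
  have h1 := hp.lev hw
  rw [hd] at h1
  obtain ⟨s, hs, hn, hp⟩ := hp
  cases b
  · obtain rfl : h' = h := by simpa [pt] using h1.1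
    obtain rfl : s = s' := by simpa [hs] using hs'
    exact hl.not_corner hn (by simpa [pt] using hp)
  · simp at h1

theorem OutCorner.not_arc {w : List Slice} {lev : ℕ → List Strand} (hw : Levels w lev) {h : ℕ}
    {p q : ℕ × ℕ} (hp : OutCorner w h p) : ¬ Arc w lev q p := by
  rintro ⟨h', s', y, ⟨b, i⟩, hs', hl, -, rfl, -, hd⟩
  have h1 := hp.lev hw
  rw [hd] at h1
  obtain ⟨s, hs, hn, hp⟩ := hp
  cases b
  · simp at h1
  · obtain rfl : h' = h := by simpa [pt] using h1.1
    obtain rfl : s = s' := by simpa [hs] using hs'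
    exact hl.symm.not_corner hn (by simpa [pt] using hp)

theorem Link.arc_or {w : List Slice} {lev : ℕ → List Strand} {h : ℕ} {s : Slice}
    (hs : w[h]? = some s) {x y : Bool × ℕ} (hl : Link s x y) {d e : Strand}
    (hx : (lev (pt h x).1)[(pt h x).2]? = some d) (hy : (lev (pt h y).1)[(pt h y).2]? = some e)
    (hde : d = e ↔ x.1 ≠ y.1) :
    Arc w lev (pt h x) (pt h y) ∨ Arc w lev (pt h y) (pt h x) := by
  have key : (d = (if x.1 then down else up) ∧ e = if y.1 then up else down) ∨
      (e = (if y.1 then down else up) ∧ d = if x.1 then up else down) := by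
    obtain ⟨b, i⟩ := x
    obtain ⟨c, j⟩ := y
    cases d <;> cases e <;> cases b <;> cases c <;> simp_all
  rcases key with ⟨rfl, rfl⟩ | ⟨rfl, rfl⟩
  · exact Or.inl ⟨h, s, x, y, hs, hl, rfl, rfl, hx, hy⟩
  · exact Or.inr ⟨h, s, y, x, hs, hl.symm, rfl, rfl, hy, hx⟩

/-- This turns the unoriented relation of the connectedness hypothesis into oriented arcs and
passages through crossings. -/
theorem Joined.arc_or {w : List Slice} {lev : ℕ → List Strand} (hw : Levels w lev)
    (h0 : lev 0 = [up]) {p q : ℕ × ℕ} (hpq : Joined w p q) :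
    Arc w lev p q ∨ Arc w lev q p ∨ ∃ h, InCorner w h p ∧ OutCorner w h q := by
  rw [← or_assoc]
  cases hpq
  case left h i s hs hi =>
    obtain ⟨L, R, h1, h2, h3⟩ := hw h s hs
    have hi' : i < L.length := h1 ▸ hi
    refine Or.inl ((Link.leftUp i hi).arc_or hs (d := L[i]) (e := L[i]) ?_ ?_ (by simp))
    · simp only [pt, Bool.toNat_false, add_zero, h2, getElem?_append_left₃ _ _ _ hi',
        List.getElem?_eq_getElem hi']
    · simp only [pt, Bool.toNat_true, h3, getElem?_append_left₃ _ _ _ hi',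
        List.getElem?_eq_getElem hi']
  case right h i s hs hi =>
    obtain ⟨L, R, h1, h2, h3⟩ := hw h s hs
    rw [hw.width_take h0 (List.getElem?_eq_some_iff.mp hs).1.le, h2, h1] at hi
    have hi' : i < R.length := by
      simp only [List.length_append] at hi
      omega
    refine Or.inl ((Link.rightUp i).arc_or hs (d := R[i]) (e := R[i]) ?_ ?_ (by simp))
    · simp only [pt, Bool.toNat_false, add_zero, h2, h1, getElem?_append_right₃,
        List.getElem?_eq_getElem hi']
    · simp only [pt, Bool.toNat_true, h3, h1, getElem?_append_right₃,
        List.getElem?_eq_getElem hi']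
  case rising h s hs hp =>
    exact Or.inr ⟨h, ⟨s, hs, hp, Or.inl rfl⟩, ⟨s, hs, hp, Or.inr rfl⟩⟩
  case falling h s hs hp =>
    exact Or.inr ⟨h, ⟨s, hs, hp, Or.inr rfl⟩, ⟨s, hs, hp, Or.inl rfl⟩⟩
  case cup h s hs hp =>
    obtain ⟨L, R, h1, h2, h3⟩ := hw h s hs
    left
    have hl := Link.cupRight hp
    have e1 : (lev (h + 1))[s.left]? = s.piece.top[0]? := by
      rw [h3, h1]
      exact getElem?_append_mid₃ L _ R (i := 0) (by rw [Piece.length_top_of_bot hp]; omega)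
    have e2 : (lev (h + 1))[s.left + 1]? = s.piece.top[1]? := by
      rw [h3, h1]
      exact getElem?_append_mid₃ L _ R (i := 1) (by rw [Piece.length_top_of_bot hp]; omega)
    rcases hpc : s.piece <;> rw [hpc] at hp e1 e2 <;> cases hp
    · exact hl.arc_or hs e1 e2 (by simp)
    · exact hl.arc_or hs e1 e2 (by simp)
  case cap h s hs hp =>
    obtain ⟨L, R, h1, h2, h3⟩ := hw h s hs
    left
    have hl := Link.capRight hp
    have e1 : (lev h)[s.left]? = s.piece.bot[0]? := by
      rw [h2, h1]
      exact getElem?_append_mid₃ L _ R (i := 0) (by rw [Piece.length_bot_of_top hp]; omega)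
    have e2 : (lev h)[s.left + 1]? = s.piece.bot[1]? := by
      rw [h2, h1]
      exact getElem?_append_mid₃ L _ R (i := 1) (by rw [Piece.length_bot_of_top hp]; omega)
    rcases hpc : s.piece <;> rw [hpc] at hp e1 e2 <;> cases hp
    · exact hl.arc_or hs e1 e2 (by simp)
    · exact hl.arc_or hs e1 e2 (by simp)

open Relation in
/-- In a connected diagram with at least two crossings, some edge connects two of them. -/
theorem exists_edge {w : List Slice} {lev : ℕ → List Strand} (hw : Levels w lev)
    (h0 : lev 0 = [up])
    (hc : ∀ p q : ℕ × ℕ, IsPoint w p → IsPoint w q → EqvGen (Joined w) p q)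
    {P₀ Q₀ : ℕ} {p₀ q₀ : ℕ × ℕ} (hP : InCorner w P₀ p₀) (hQ : InCorner w Q₀ q₀) (hPQ : P₀ ≠ Q₀) :
    ∃ P Q p q, P ≠ Q ∧ OutCorner w P p ∧ InCorner w Q q ∧ ReflTransGen (Arc w lev) p q := by
  by_contra! H
  have H' : ∀ P Q p q, OutCorner w P p → InCorner w Q q → ReflTransGen (Arc w lev) p q → P = Q :=
    fun P Q p q h1 h2 h3 => by_contra fun h => H P Q p q h h1 h2 h3
  -- The points on the edges that end or start at the crossing `P₀`. If no edge connects different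
  -- crossings, this set is closed under `Joined`, so by connectedness it contains a corner of `Q₀`,
  -- which is absurd.
  set C : ℕ × ℕ → Prop := fun p => (∃ q, InCorner w P₀ q ∧ ReflTransGen (Arc w lev) p q) ∨
    ∃ q, OutCorner w P₀ q ∧ ReflTransGen (Arc w lev) q p
  have harc : ∀ p q, Arc w lev p q → (C p ↔ C q) := by
    intro p q hpq
    constructor
    · rintro (⟨c, hc, h⟩ | ⟨c, hc, h⟩)
      · rcases h.cases_head with rfl | ⟨q', h1, h2⟩
        · exact (hc.not_arc hw hpq).elim
        · exact Or.inl ⟨c, hc, hpq.right_unique h1 ▸ h2⟩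
      · exact Or.inr ⟨c, hc, h.tail hpq⟩
    · rintro (⟨c, hc, h⟩ | ⟨c, hc, h⟩)
      · exact Or.inl ⟨c, hc, h.head hpq⟩
      · rcases h.cases_tail with rfl | ⟨q', h1, h2⟩
        · exact (hc.not_arc hw hpq).elim
        · exact Or.inr ⟨c, hc, hpq.left_unique h2 ▸ h1⟩
  have hin : ∀ h p, InCorner w h p → C p → h = P₀ := by
    rintro h p hp (⟨c, hc, h1⟩ | ⟨c, hc, h1⟩)
    · rcases h1.cases_head with rfl | ⟨q', h1, h2⟩
      · exact (hp.lev hw).1.symm.trans (hc.lev hw).1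
      · exact (hp.not_arc hw h1).elim
    · exact (H' _ _ _ _ hc hp h1).symm
  have hout : ∀ h p, OutCorner w h p → C p → h = P₀ := by
    rintro h p hp (⟨c, hc, h1⟩ | ⟨c, hc, h1⟩)
    · exact H' _ _ _ _ hp hc h1
    · rcases h1.cases_tail with rfl | ⟨q', h1, h2⟩
      · exact Nat.succ_injective ((hp.lev hw).1.symm.trans (hc.lev hw).1)
      · exact (hp.not_arc hw h2).elim
  have hjoin : ∀ p q, Joined w p q → (C p ↔ C q) := by
    intro p q hpq
    rcases hpq.arc_or hw h0 with h | h | ⟨h, hp, hq⟩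
    · exact harc p q h
    · exact (harc q p h).symm
    · constructor
      · intro h1
        obtain rfl := hin h p hp h1
        exact Or.inr ⟨q, hq, .refl⟩
      · intro h1
        obtain rfl := hout h q hq h1
        exact Or.inl ⟨p, hp, .refl⟩
  have hgen : ∀ p q, EqvGen (Joined w) p q → (C p ↔ C q) := by
    intro p q h
    induction h with
    | rel p q h => exact hjoin p q h
    | refl p => rfl
    | symm p q _ ih => exact ih.symm
    | trans p q r _ _ ih₁ ih₂ => exact ih₁.trans ih₂
  have hpoint : ∀ h p, InCorner w h p → IsPoint w p := by
    intro h p hp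
    have h1 := hp.lev hw
    obtain ⟨s, hs, -, -⟩ := hp
    have h2 : p.1 ≤ w.length := h1.1 ▸ (List.getElem?_eq_some_iff.mp hs).1.le
    refine ⟨h2, ?_⟩
    rw [hw.width_take h0 h2]
    exact (List.getElem?_eq_some_iff.mp h1.2).1
  have h1 : C p₀ := Or.inl ⟨p₀, hP, .refl⟩
  have h2 := (hgen p₀ q₀ (hc _ _ (hpoint _ _ hP) (hpoint _ _ hQ))).mp h1
  exact hPQ (hin _ _ hQ h2).symm

/-! ### Colors along the edges -/

theorem IsState.valid_level {n : ℕ} {w : List Slice} {lev : ℕ → List Strand} (hw : Levels w lev)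
    {σ : ℕ → List ℕ} {κ : ℕ → ℕ} (hσ : IsState n w σ κ) (h0 : Valid n (lev 0) (σ 0)) {h : ℕ}
    (hh : h ≤ w.length) : Valid n (lev h) (σ h) := by
  have h1 : IsState n (w.take h) σ κ := fun h' s hs => hσ h' s (by
    rw [List.getElem?_take] at hs
    split_ifs at hs
    exact hs)
  have h2 := h1.valid (hw.take h).isTangle h0
  rwa [List.length_take, min_eq_left hh] at h2

theorem IsState.slice {n : ℕ} {w : List Slice} {lev : ℕ → List Strand} (hw : Levels w lev)
    {σ : ℕ → List ℕ} {κ : ℕ → ℕ} (hσ : IsState n w σ κ) (h0 : Valid n (lev 0) (σ 0)) {h : ℕ}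
    {s : Slice} (hs : w[h]? = some s) :
    ∃ l m r, s.left = l.length ∧ σ h = l ++ m ++ r ∧
      σ (h + 1) = l ++ pieceOut s.piece (κ h) m ++ r ∧ Valid n s.piece.bot m ∧
      Valid n s.piece.top (pieceOut s.piece (κ h) m) ∧ pieceWt n s.piece (κ h) m ≠ 0 := by
  have hv := hσ.valid_level hw h0 (List.getElem?_eq_some_iff.mp hs).1.le
  obtain ⟨hk, hwt, hout⟩ := hσ h s hs
  obtain ⟨L, R, h1, h2, -⟩ := hw h s hs
  rw [h2] at hv
  obtain ⟨i', r, hi, hi', hr⟩ := hv.exists_append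
  obtain ⟨l, m, rfl, hl, hm⟩ := hi'.exists_append
  obtain ⟨left, p⟩ := s
  simp only at h1
  obtain rfl : left = l.length := h1.trans hl.1.symm
  rw [hi, mid_append l m r p hm.1] at hwt
  rw [hi, sliceOut_append l m r p hm.1] at hout
  exact ⟨l, m, r, rfl, hi, hout, hm, (pieceOut_valid hk hm hwt).1, hwt⟩

/-- The color of a point in a state. -/
def col (σ : ℕ → List ℕ) (p : ℕ × ℕ) : Option ℕ := (σ p.1)[p.2]?

/-- Vertical strands copy their colors, cups create two equal ones, and a cap has nonzero weight
only if its colors agree. -/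
theorem IsState.col_link {n : ℕ} {w : List Slice} {lev : ℕ → List Strand} (hw : Levels w lev)
    {σ : ℕ → List ℕ} {κ : ℕ → ℕ} (hσ : IsState n w σ κ) (h0 : Valid n (lev 0) (σ 0)) {h : ℕ}
    {s : Slice} (hs : w[h]? = some s) {x y : Bool × ℕ} (hl : Link s x y) :
    col σ (pt h x) = col σ (pt h y) := by
  obtain ⟨l, m, r, h1, h2, h3, hm, hm', hwt⟩ := hσ.slice hw h0 hs
  have hleft (i : ℕ) (hi : i < s.left) : col σ (pt h (false, i)) = col σ (pt h (true, i)) := by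
    rw [h1] at hi
    simp only [col, pt, Bool.toNat_false, Bool.toNat_true, add_zero, h2, h3,
      getElem?_append_left₃ _ _ _ hi]
  have hright (i : ℕ) : col σ (pt h (false, s.left + s.piece.bot.length + i)) =
      col σ (pt h (true, s.left + s.piece.top.length + i)) := by
    simp only [col, pt, Bool.toNat_false, Bool.toNat_true, add_zero, h2, h3, h1, ← hm.1, ← hm'.1,
      getElem?_append_right₃]
  have hcup (hp : s.piece.bot = []) :
      col σ (pt h (true, s.left)) = col σ (pt h (true, s.left + 1)) := by
    have hl2 := hm'.1
    rw [Piece.length_top_of_bot hp] at hl2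
    have e0 := getElem?_append_mid₃ l (pieceOut s.piece (κ h) m) r (i := 0) (by omega)
    have e1 := getElem?_append_mid₃ l (pieceOut s.piece (κ h) m) r (i := 1) (by omega)
    simp only [col, pt, Bool.toNat_true, h3, h1]
    rw [add_zero] at e0
    rw [e0, e1]
    obtain rfl : m = [] := List.length_eq_zero_iff.mp (hm.1.trans (by rw [hp]; rfl))
    rcases hpc : s.piece <;> rw [hpc] at hp <;> cases hp <;> rfl
  have hcap (hp : s.piece.top = []) :
      col σ (pt h (false, s.left)) = col σ (pt h (false, s.left + 1)) := by
    have hl2 := hm.1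
    rw [Piece.length_bot_of_top hp] at hl2
    obtain ⟨a, b, rfl⟩ := List.length_eq_two.mp hl2
    have hab : a = b := by
      by_contra hab
      refine hwt ?_
      rcases hpc : s.piece <;> rw [hpc] at hp <;> cases hp <;>
        exact if_neg fun h => hab h.2
    simp [col, pt, h2, h1, hab]
  cases hl
  · exact hleft _ ‹_›
  · exact (hleft _ ‹_›).symm
  · exact hright _
  · exact (hright _).symm
  · exact hcup ‹_›
  · exact (hcup ‹_›).symm
  · exact hcap ‹_›
  · exact (hcap ‹_›).symm

theorem IsState.col_edge {n : ℕ} {w : List Slice} {lev : ℕ → List Strand} (hw : Levels w lev)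
    {σ : ℕ → List ℕ} {κ : ℕ → ℕ} (hσ : IsState n w σ κ) (h0 : Valid n (lev 0) (σ 0))
    {p q : ℕ × ℕ} (hpq : Relation.ReflTransGen (Arc w lev) p q) : col σ p = col σ q := by
  induction hpq with
  | refl => rfl
  | tail _ h ih =>
    obtain ⟨h, s, x, y, hs, hl, rfl, rfl, -, -⟩ := h
    exact ih.trans (hσ.col_link hw h0 hs hl)

/-- The point below the crossing in the slice `h`, on the overpass or on the underpass. -/
def cornerIn (s : Slice) (h : ℕ) (o : Bool) : ℕ × ℕ :=
  (h, if (s.piece.sign = 1 ↔ o = true) then s.left else s.left + 1)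

/-- The point above the crossing in the slice `h`, on the overpass or on the underpass. -/
def cornerOut (s : Slice) (h : ℕ) (o : Bool) : ℕ × ℕ :=
  (h + 1, if (s.piece.sign = 1 ↔ o = true) then s.left + 1 else s.left)

theorem InCorner.exists_eq {w : List Slice} {h : ℕ} {p : ℕ × ℕ} (hp : InCorner w h p) :
    ∃ s o, w[h]? = some s ∧ s.piece.sign ≠ 0 ∧ p = cornerIn s h o := by
  obtain ⟨s, hs, hn, hp⟩ := hp
  by_cases h1 : s.piece.sign = 1
  · rcases hp with rfl | rfl
    · exact ⟨s, true, hs, hn, by simp [cornerIn, h1]⟩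
    · exact ⟨s, false, hs, hn, by simp [cornerIn, h1]⟩
  · rcases hp with rfl | rfl
    · exact ⟨s, false, hs, hn, by simp [cornerIn, h1]⟩
    · exact ⟨s, true, hs, hn, by simp [cornerIn, h1]⟩

theorem OutCorner.exists_eq {w : List Slice} {h : ℕ} {p : ℕ × ℕ} (hp : OutCorner w h p) :
    ∃ s o, w[h]? = some s ∧ s.piece.sign ≠ 0 ∧ p = cornerOut s h o := by
  obtain ⟨s, hs, hn, hp⟩ := hp
  by_cases h1 : s.piece.sign = 1
  · rcases hp with rfl | rfl
    · exact ⟨s, false, hs, hn, by simp [cornerOut, h1]⟩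
    · exact ⟨s, true, hs, hn, by simp [cornerOut, h1]⟩
  · rcases hp with rfl | rfl
    · exact ⟨s, true, hs, hn, by simp [cornerOut, h1]⟩
    · exact ⟨s, false, hs, hn, by simp [cornerOut, h1]⟩

theorem inCorner_cornerIn {w : List Slice} {h : ℕ} {s : Slice} (hs : w[h]? = some s)
    (hn : s.piece.sign ≠ 0) (o : Bool) : InCorner w h (cornerIn s h o) := by
  refine ⟨s, hs, hn, ?_⟩
  rw [cornerIn]
  split_ifs <;> simp

/-- In terms of overpass and underpass the two signs of crossings obey the same rule, and the
inequalities are the conditions for a nonzero weight. -/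
theorem IsState.col_crossing {n : ℕ} {w : List Slice} {lev : ℕ → List Strand} (hw : Levels w lev)
    {σ : ℕ → List ℕ} {κ : ℕ → ℕ} (hσ : IsState n w σ κ) (h0 : Valid n (lev 0) (σ 0)) {h : ℕ}
    {s : Slice} (hs : w[h]? = some s) (hn : s.piece.sign ≠ 0) :
    ∃ a b, κ h ≤ a ∧ a < n ∧ b + κ h < n ∧
      col σ (cornerIn s h true) = some a ∧ col σ (cornerOut s h true) = some (a - κ h) ∧
      col σ (cornerIn s h false) = some b ∧ col σ (cornerOut s h false) = some (b + κ h) := by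
  obtain ⟨l, m, r, h1, h2, h3, hm, -, hwt⟩ := hσ.slice hw h0 hs
  obtain ⟨left, p⟩ := s
  simp only at h1 hn
  subst h1
  cases p
  case posCrossing =>
    obtain ⟨a, b, rfl⟩ := List.length_eq_two.mp hm.1
    have hk : κ h ≤ a ∧ b + κ h < n := by
      by_contra hk
      exact hwt (posWt_neg hk)
    refine ⟨a, b, hk.1, hm.2 a (by simp), hk.2, ?_⟩
    simp [col, cornerIn, cornerOut, h2, h3, Piece.sign, pieceOut]
  case negCrossing =>
    obtain ⟨a, b, rfl⟩ := List.length_eq_two.mp hm.1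
    have hk : κ h ≤ b ∧ a + κ h < n := by
      by_contra hk
      exact hwt (negWt_neg hk)
    refine ⟨b, a, hk.1, hm.2 b (by simp), hk.2, ?_⟩
    simp [col, cornerIn, cornerOut, h2, h3, Piece.sign, pieceOut]
  all_goals exact absurd rfl hn

/-- Some edge of a connected diagram can be given an extreme color in such a way that the angle
variables of two crossings vanish. -/
theorem exists_point_color {w : List Slice} {lev : ℕ → List Strand} (hw : Levels w lev)
    {P Q : ℕ} {p q : ℕ × ℕ} (hp : OutCorner w P p) (hq : InCorner w Q q)
    (hpq : Relation.ReflTransGen (Arc w lev) p q) :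
    ∃ h e, InCorner w h e ∧ ∃ a : ℕ → ℕ, (∀ n, 0 < n → a n < n) ∧
      ∀ n σ κ, IsState n w σ κ → Valid n (lev 0) (σ 0) → col σ e = some (a n) →
        κ P = 0 ∧ κ Q = 0 := by
  obtain ⟨s, o, hs, hsn, rfl⟩ := hp.exists_eq
  obtain ⟨s', o', hs', hsn', rfl⟩ := hq.exists_eq
  have key {n : ℕ} {σ : ℕ → List ℕ} {κ : ℕ → ℕ} (hσ : IsState n w σ κ)
      (h0 : Valid n (lev 0) (σ 0)) := hσ.col_edge hw h0 hpq
  cases o <;> cases o'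
  -- Under `P`, then under `Q`: colors do not decrease, so the maximal color before `P` persists
  -- through both.
  · refine ⟨P, _, inCorner_cornerIn hs hsn false, fun n => n - 1, fun n hn => Nat.sub_one_lt hn.ne',
      fun n σ κ hσ h0 he => ?_⟩
    obtain ⟨a, b, ha, han, hb, h1, h2, h3, h4⟩ := hσ.col_crossing hw h0 hs hsn
    obtain ⟨a', b', ha', han', hb', h1', h2', h3', h4'⟩ := hσ.col_crossing hw h0 hs' hsn'
    have hk := key hσ h0
    rw [h4, h3', Option.some_inj] at hk
    rw [h3, Option.some_inj] at he
    beta_reduce at he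
    omega
  -- Under `P`, then over `Q`: the color `0` between them is reached from below and cannot decrease
  -- further.
  · refine ⟨Q, _, inCorner_cornerIn hs' hsn' true, fun n => 0, fun n hn => hn,
      fun n σ κ hσ h0 he => ?_⟩
    obtain ⟨a, b, ha, han, hb, h1, h2, h3, h4⟩ := hσ.col_crossing hw h0 hs hsn
    obtain ⟨a', b', ha', han', hb', h1', h2', h3', h4'⟩ := hσ.col_crossing hw h0 hs' hsn'
    have hk := key hσ h0
    rw [h4, h1', Option.some_inj] at hk
    rw [h1', Option.some_inj] at he
    beta_reduce at he
    omega
  -- Over `P`, then under `Q`: the maximal color between them is reached from above and cannot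
  -- increase further.
  · refine ⟨Q, _, inCorner_cornerIn hs' hsn' false, fun n => n - 1, fun n hn => Nat.sub_one_lt hn.ne',
      fun n σ κ hσ h0 he => ?_⟩
    obtain ⟨a, b, ha, han, hb, h1, h2, h3, h4⟩ := hσ.col_crossing hw h0 hs hsn
    obtain ⟨a', b', ha', han', hb', h1', h2', h3', h4'⟩ := hσ.col_crossing hw h0 hs' hsn'
    have hk := key hσ h0
    rw [h2, h3', Option.some_inj] at hk
    rw [h3', Option.some_inj] at he
    beta_reduce at he
    omega
  -- Over `P`, then over `Q`: colors do not increase, so the color `0` before `P` persists through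
  -- both.
  · refine ⟨P, _, inCorner_cornerIn hs hsn true, fun n => 0, fun n hn => hn,
      fun n σ κ hσ h0 he => ?_⟩
    obtain ⟨a, b, ha, han, hb, h1, h2, h3, h4⟩ := hσ.col_crossing hw h0 hs hsn
    obtain ⟨a', b', ha', han', hb', h1', h2', h3', h4'⟩ := hσ.col_crossing hw h0 hs' hsn'
    have hk := key hσ h0
    rw [h2, h1', Option.some_inj] at hk
    rw [h1, Option.some_inj] at he
    beta_reduce at he
    omega

/-! ### The upper bound -/

theorem exists_crossing {w : List Slice} (h : 0 < wordCrossings w) :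
    ∃ (P : ℕ) (s : Slice), w[P]? = some s ∧ s.piece.sign ≠ 0 := by
  obtain ⟨s, hs⟩ := List.exists_mem_of_length_pos h
  rw [List.mem_filter] at hs
  obtain ⟨P, hP⟩ := List.mem_iff_getElem?.mp hs.1
  exact ⟨P, s, hP, by simpa using hs.2⟩

theorem exists_two_crossings {w : List Slice} (h : 1 < wordCrossings w) :
    ∃ (P Q : ℕ) (s s' : Slice), P ≠ Q ∧ w[P]? = some s ∧ s.piece.sign ≠ 0 ∧ w[Q]? = some s' ∧
      s'.piece.sign ≠ 0 := by
  induction w with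
  | nil => simp [wordCrossings] at h
  | cons s w ih =>
    by_cases hs : s.piece.sign = 0
    · have h1 : wordCrossings (s :: w) = wordCrossings w := by simp [wordCrossings, hs]
      obtain ⟨P, Q, s₁, s₂, h2, h3, h4, h5, h6⟩ := ih (h1 ▸ h)
      exact ⟨P + 1, Q + 1, s₁, s₂, by simpa using h2, by simpa using h3, h4, by simpa using h5, h6⟩
    · have h1 : wordCrossings (s :: w) = wordCrossings w + 1 := by simp [wordCrossings, hs]
      obtain ⟨Q, s', h2, h3⟩ := exists_crossing (w := w) (by omega)
      exact ⟨0, Q + 1, s, s', by simp, rfl, hs, by simpa using h2, h3⟩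

theorem norm_ev_coloredJones_le (c : ℕ) (K : LongKnotDiagram) (hK : K.crossings = c + 2) (α : ℝ)
    {n : ℕ} (hn : 0 < n) :
    ‖ev α n (coloredJones K n)‖ ≤ (n : ℝ) ^ (K.word.length + 1) * (4 ^ n) ^ c := by
  obtain ⟨w, hw, hconn⟩ := K
  have hcr : wordCrossings w = c + 2 := hK
  obtain ⟨lev, hl0, hlt, hlev⟩ := hw.exists_levels
  obtain ⟨P₀, Q₀, s₀, t₀, hne, hP₀, hs₀, hQ₀, ht₀⟩ := exists_two_crossings (w := w) (by omega)
  obtain ⟨P, Q, p, q, hPQ, hp, hq, hpq⟩ := exists_edge hlev hl0 hconn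
    (inCorner_cornerIn hP₀ hs₀ true) (inCorner_cornerIn hQ₀ ht₀ true) hne
  obtain ⟨h, e, he, a, ha, hstate⟩ := exists_point_color hlev hp hq hpq
  obtain ⟨he1, he2⟩ := he.lev hlev
  have hh : h ≤ w.length := by
    obtain ⟨s, hs, -⟩ := he
    exact (List.getElem?_eq_some_iff.mp hs).1.le
  rw [he1] at he2
  obtain ⟨hi, hup⟩ := List.getElem?_eq_some_iff.mp he2
  set L := (lev h).take e.2 with hL
  set R := (lev h).drop (e.2 + 1)
  have hLlen : L.length = e.2 := by rw [hL, List.length_take, min_eq_left hi.le]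
  have hdec : lev h = L ++ [up] ++ R := by
    rw [hL, ← hup, List.append_assoc, List.singleton_append, List.getElem_cons_drop,
      List.take_append_drop]
  have hw₁ : IsTangle (w.take h) [up] (L ++ [up] ++ R) := by
    have h1 := (hlev.take h).isTangle
    rwa [List.length_take, min_eq_left hh, hl0, hdec] at h1
  have hw₂ : IsTangle (w.drop h) (L ++ [up] ++ R) [up] := by
    have h1 := (hlev.drop h).isTangle
    rwa [List.length_drop, Nat.add_sub_cancel' hh, hlt, add_zero, hdec] at h1
  have htd : w.take h ++ w.drop h = w := List.take_append_drop h w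
  have hJ := cutSum_eq_stateSum hw₁ hw₂ (by rwa [htd]) (ha n hn)
  rw [htd] at hJ
  -- With the color `a n` at the chosen point two of the `c + 2` crossings have angle zero in every
  -- state, so `c` factors `4 ^ n` remain.
  have hbound := norm_evHom_cutSum_le α hw₁ hw₂ (a := a n) (B := (4 ^ n) ^ c) (by positivity)
    fun σ κ hσ h0 hcol => by
      rw [htd] at hσ ⊢
      rw [List.length_take, min_eq_left hh, hLlen] at hcol
      obtain ⟨hκP, hκQ⟩ := hstate n σ κ hσ (by rwa [hl0]) (by rw [col, he1, hcol])
      obtain ⟨s, hs, hsn, -⟩ := hp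
      obtain ⟨s', hs', hsn', -⟩ := hq
      have h4 : (0 : ℝ) < 4 ^ n := by positivity
      have key : stateCost n w κ * 4 ^ n * 4 ^ n ≤ (4 ^ n) ^ (c + 2) := by
        rw [← hcr]
        rcases lt_or_gt_of_ne hPQ with hlt | hlt
        · exact stateCost_mul_mul_le n w κ hlt hs hsn hκP hs' hsn' hκQ
        · exact stateCost_mul_mul_le n w κ hlt hs' hsn' hκQ hs hsn hκP
      rw [pow_add, pow_two, ← mul_assoc] at key
      exact le_of_mul_le_mul_right (le_of_mul_le_mul_right key h4) h4
  rw [hJ, htd] at hbound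
  have hev : ev α n (coloredJones ⟨w, hw, hconn⟩ n) =
      evHom α n (coloredJones ⟨w, hw, hconn⟩ n) := rfl
  rw [hev, coloredJones, map_mul, norm_mul, norm_evHom_T, one_mul]
  exact hbound

end ColoredJones

end

/-! ### Passage to the growth rate -/

theorem theorem1 (c : ℕ) (K : ColoredJones.LongKnotDiagram) (hK : K.crossings = c + 2)
    (α : ℝ) (hα : 0 < α) :
    Filter.limsup (fun n : ℕ =>
        ENNReal.log ‖ColoredJones.ev α n (ColoredJones.coloredJones K n)‖ₑ / (n : EReal))
      Filter.atTop ≤ ((c * Real.log 4 : ℝ) : EReal) := by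
  set M := K.word.length + 1
  -- The number of states contributes only the term with `log n / n`, which tends to zero.
  have hlim : Filter.Tendsto (fun n : ℕ => M * (Real.log n / n) + c * Real.log 4) Filter.atTop
      (nhds (c * Real.log 4)) := by
    have h1 : Filter.Tendsto (fun n : ℕ => Real.log n / n) Filter.atTop (nhds 0) :=
      (Real.isLittleO_log_id_atTop.tendsto_div_nhds_zero).comp tendsto_natCast_atTop_atTop
    simpa using (h1.const_mul (M : ℝ)).add_const (c * Real.log 4)
  refine (Filter.limsup_le_limsup (v := fun n : ℕ =>
    ((M * (Real.log n / n) + c * Real.log 4 : ℝ) : EReal)) ?_).trans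
      (((continuous_coe_real_ereal.tendsto _).comp hlim).limsup_eq).le
  filter_upwards [Filter.eventually_gt_atTop 0] with n hn
  have hn' : (0 : ℝ) < n := by exact_mod_cast hn
  have h1 := ColoredJones.norm_ev_coloredJones_le c K hK α hn
  have h2 : ENNReal.log ‖ColoredJones.ev α n (ColoredJones.coloredJones K n)‖ₑ ≤
      ((M * Real.log n + n * (c * Real.log 4) : ℝ) : EReal) := by
    rw [← ofReal_norm]
    -- Monotonicity of `ENNReal.log` covers the value `0` as well, where the logarithm is `⊥`.
    refine (ENNReal.log_le_log (ENNReal.ofReal_le_ofReal h1)).trans (le_of_eq ?_)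
    rw [ENNReal.log_ofReal_of_pos (by positivity), Real.log_mul (by positivity) (by positivity),
      Real.log_pow, Real.log_pow, Real.log_pow]
    congr 1
    ring
  rw [EReal.div_le_iff_le_mul (by exact_mod_cast hn) (EReal.natCast_ne_top n)]
  refine h2.trans (le_of_eq ?_)
  rw [← EReal.coe_coe_eq_natCast, ← EReal.coe_mul]
  congr 1
  field_simp
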